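/- **Theorem 2.** *Setting.* Identify a Hilbert–Schmidt operator $F$ on $L^2[0,1]^2$ with its kernel $f\in L^2([0,1]^4)$; $\|F\|_2=\|f\|_{L^2}$ is the Hilbert–Schmidt norm, and $A_1\tilde\otimes A_2$ has kernel $a_1(t,t')\,a_2(s,s')$. For a trace-class $C$ on $L^2[0,1]^2$ with kernel $c$ and $\delta\in[0,1)$ let $\mathrm{Tr}^\delta(C)$ be the trace of the operator with kernel $c(t,s,t'+\delta,s'+\delta)$ ($c$ extended by zero), and let $\mathrm{Tr}_1^\delta(C)$, $\mathrm{Tr}_2^\delta(C)$ be the partial trace over the second variable of the operator with kernel $c(t,s,t',s'+\delta)$, respectively over the first variable of the operator with kernel $c(t,s,t'+\delta,s')$. For continuous $c$, $$\mathrm{Tr}^\delta(C)=\int_0^{1-\delta}\!\!\int_0^{1-\delta} c(t,s,t+\delta,s+\delta)\,dt\,ds,$$ and $\mathrm{Tr}_1^\delta(C)$, $\mathrm{Tr}_2^\delta(C)$ have the kernels $\int_0^{1-\delta}c(t,s,t',s+\delta)\,ds$ and $\int_0^{1-\delta}c(t,s,t+\delta,s')\,dt$. An operator $B$ with kernel $b$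 is *banded by* $\delta$ if $b=0$ almost everywhere on $\{\max(|t-t'|,|s-s'|)\ge\delta\}$, and *stationary* if $b(t,s,t',s')=\varsigma(|t-t'|,|s-s'|)$ almost everywhere for some function $\varsigma$. Toeplitz averaging $\mathrm{Ta}$ is the orthogonal projection, in the Hilbert–Schmidt inner product, onto the stationary operators. For trace-class $C$ with $\mathrm{Tr}^\delta(C)\ne0$ put $$A_1(\delta)=\mathrm{Tr}_1^\delta(C),\quad A_2(\delta)=\frac{\mathrm{Tr}_2^\delta(C)}{\mathrm{Tr}^\delta(C)},\quad B(\delta)=\mathrm{Ta}\big(C-A_1(\delta)\tilde\otimes A_2(\delta)\big),\quad C(\delta)=A_1(\delta)\tilde\otimes A_2(\delta)+B(\delta).$$ Given surfaces $X_1,\dots,X_N$, let $\widehat C_N=\frac1N\sum_n (X_n-\bar X_N)\otimes(X_n-\bar X_N)$, let $\widehat A_1(\delta),\widehat A_2(\delta),\widehat B(\delta),\widehat C(\delta)$ be given by the same formulas with $\widehat C_N$ in place of $C$, and let $\widehat C_{-n}(\delta)$ be $\widehat C(\delta)$ computed without $X_n$. *Statement.* Let $X_1,X_2,\dots$ be i.i.d.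 copies of a centered random element $X$ of $L^2[0,1]^2$ with $\sum_{j}\big(\mathbb E\langle X,e_j\rangle^4\big)^{1/4}<\infty$ for some orthonormal basis $(e_j)$ of $L^2[0,1]^2$, and with covariance $C=A_1\tilde\otimes A_2+B$, where $A_1,A_2,B$ are trace class and positive semi-definite, and $B$ is stationary and banded by $\delta^\star\in[0,1)$. Let $\Delta\subset[0,1)$ be a finite grid such that $\mathrm{Tr}^\delta(C)\ne0$ for all $\delta\in\Delta$ and some $\delta\in\Delta$ satisfies $\delta\ge\delta^\star$. Let $\delta^\star$ be at most the smallest minimiser over $\Delta$ of $\Xi(\delta)=\|C(\delta)-C\|_2^2$. For each $N\ge2$ let $$\widehat\delta\in\operatorname*{arg\,min}_{\delta\in\Delta}\ \|\widehat C(\delta)\|_2^2-\frac2N\sum_{n=1}^N\langle X_n,\widehat C_{-n}(\delta)X_n\rangle .$$ Then, as $N\to\infty$, $$\big\|\widehat A_1(\widehat\delta)\tilde\otimes\widehat A_2(\widehat\delta)-A_1\tilde\otimes A_2\big\|_2^2=O_P(N^{-1})\qquad\text{and}\qquad \big\|\widehat B(\widehat\delta)-B\big\|_2^2=O_P(N^{-1}).$$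 -/

import Mathlib

open MeasureTheory ProbabilityTheory Filter Topology unitInterval
open scoped ENNReal

noncomputable section

namespace SepBand

/-! ## Square-integrable functions and kernels

Hilbert-Schmidt operators on `L²(α)` are represented by their kernels `k ∈ L²(α × α)`,
`(F f)(p) = ∫ k(p, q) f(q) dq`; the Hilbert-Schmidt inner product and norm are those of
`L²(α × α)`. -/

/-- The real Hilbert space `L²(α)`. -/
abbrev L2 (α : Type*) [MeasureSpace α] : Type _ := Lp ℝ 2 (volume : Measure α)

/-- `L²[0,1]`. -/
abbrev Curve : Type := L2 I

/-- `L²[0,1]²`; the argument is `(t, s)`. -/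
abbrev Surface : Type := L2 (I × I)

/-- Kernels `a(t, t')` of Hilbert-Schmidt operators on `L²[0,1]`. -/
abbrev CurveOp : Type := L2 (I × I)

/-- Kernels `c((t, s), (t', s'))` of Hilbert-Schmidt operators on `L²[0,1]²`. -/
abbrev SurfaceOp : Type := L2 ((I × I) × (I × I))

section Outer

variable {α β : Type*} [MeasureSpace α] [MeasureSpace β]

lemma memLp_outer (x : L2 α) (y : L2 β) :
    MemLp (fun p : α × β => x p.1 * y p.2) 2 volume := by
  have hx := Lp.memLp x
  have hy := Lp.memLp y
  have hm : AEStronglyMeasurable (fun p : α × β => x p.1 * y p.2) volume :=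
    hx.1.comp_fst.mul hy.1.comp_snd
  rw [memLp_two_iff_integrable_sq hm]
  have := ((memLp_two_iff_integrable_sq hx.1).1 hx).mul_prod
    ((memLp_two_iff_integrable_sq hy.1).1 hy)
  refine this.congr (ae_of_all _ fun p => ?_)
  simp only [mul_pow]

/-- The function `(x ⊗ y)(p, q) = x(p) y(q)`. For `α = β` it is the kernel of the rank-one
operator `f ↦ ⟨y, f⟩ x`. -/
def outer (x : L2 α) (y : L2 β) : L2 (α × β) := (memLp_outer x y).toLp _

lemma coeFn_outer (x : L2 α) (y : L2 β) :
    outer x y =ᵐ[volume] fun p => x p.1 * y p.2 := (memLp_outer x y).coeFn_toLp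

lemma norm_outer [SFinite (volume : Measure α)] [SFinite (volume : Measure β)] (x : L2 α) (y : L2 β) : ‖outer x y‖ = ‖x‖ * ‖y‖ := by
  have h : ‖outer x y‖ ^ 2 = (‖x‖ * ‖y‖) ^ 2 := by
    rw [mul_pow]
    simp only [← real_inner_self_eq_norm_sq, L2.inner_def]
    rw [integral_congr_ae (g := fun p : α × β => (inner ℝ (x p.1) (x p.1) : ℝ) *
      inner ℝ (y p.2) (y p.2))]
    · exact integral_prod_mul (μ := volume) (ν := volume)
        (fun a => (inner ℝ (x a) (x a) : ℝ)) (fun b => (inner ℝ (y b) (y b) : ℝ))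
    · filter_upwards [coeFn_outer x y] with p hp
      rw [hp]
      simp only [RCLike.inner_apply, conj_trivial]
      ring
  exact (pow_left_inj₀ (norm_nonneg _) (by positivity) two_ne_zero).1 h

lemma outer_add_left (x x' : L2 α) (y : L2 β) :
    outer (x + x') y = outer x y + outer x' y := by
  apply Lp.ext
  have h : ∀ᵐ p : α × β, (x + x') p.1 = x p.1 + x' p.1 :=
    Measure.quasiMeasurePreserving_fst.ae (Lp.coeFn_add x x')
  filter_upwards [coeFn_outer (x + x') y, coeFn_outer x y, coeFn_outer x' y,
    Lp.coeFn_add (outer x y) (outer x' y), h] with p h1 h2 h3 h4 h5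
  rw [h1, h4, Pi.add_apply, h2, h3, h5, add_mul]

lemma outer_add_right (x : L2 α) (y y' : L2 β) :
    outer x (y + y') = outer x y + outer x y' := by
  apply Lp.ext
  have h : ∀ᵐ p : α × β, (y + y') p.2 = y p.2 + y' p.2 :=
    Measure.quasiMeasurePreserving_snd.ae (Lp.coeFn_add y y')
  filter_upwards [coeFn_outer x (y + y'), coeFn_outer x y, coeFn_outer x y',
    Lp.coeFn_add (outer x y) (outer x y'), h] with p h1 h2 h3 h4 h5
  rw [h1, h4, Pi.add_apply, h2, h3, h5, mul_add]

lemma outer_smul_left (r : ℝ) (x : L2 α) (y : L2 β) :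
    outer (r • x) y = r • outer x y := by
  apply Lp.ext
  have h : ∀ᵐ p : α × β, (r • x) p.1 = r • x p.1 :=
    Measure.quasiMeasurePreserving_fst.ae (Lp.coeFn_smul r x)
  filter_upwards [coeFn_outer (r • x) y, coeFn_outer x y,
    Lp.coeFn_smul r (outer x y), h] with p h1 h2 h4 h5
  rw [h1, h4, Pi.smul_apply, h2, h5, smul_eq_mul, smul_eq_mul, mul_assoc]

lemma outer_smul_right (r : ℝ) (x : L2 α) (y : L2 β) :
    outer x (r • y) = r • outer x y := by
  apply Lp.ext
  have h : ∀ᵐ p : α × β, (r • y) p.2 = r • y p.2 :=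
    Measure.quasiMeasurePreserving_snd.ae (Lp.coeFn_smul r y)
  filter_upwards [coeFn_outer x (r • y), coeFn_outer x y,
    Lp.coeFn_smul r (outer x y), h] with p h1 h2 h4 h5
  rw [h1, h4, Pi.smul_apply, h2, h5, smul_eq_mul, smul_eq_mul, mul_left_comm]

/-- `outer` as a bounded bilinear map. -/
def outerL [SFinite (volume : Measure α)] [SFinite (volume : Measure β)] :
    L2 α →L[ℝ] L2 β →L[ℝ] L2 (α × β) :=
  LinearMap.mkContinuous₂ (LinearMap.mk₂ ℝ outer outer_add_left outer_smul_left outer_add_right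
    outer_smul_right) 1 fun x y => by
      rw [one_mul, LinearMap.mk₂_apply, norm_outer]

end Outer

section Schatten

variable {α : Type*} [MeasureSpace α]

/-- The operator with kernel `k` is trace class: it has a singular value decomposition
`∑ⱼ wⱼ eⱼ ⊗ fⱼ` with `wⱼ ≥ 0`, `eⱼ` and `fⱼ` orthonormal, and `∑ⱼ wⱼ < ∞`. -/
def IsTraceClass (k : L2 (α × α)) : Prop :=
  ∃ (w : ℕ → ℝ) (e f : ℕ → L2 α), (∀ j, 0 ≤ w j) ∧ Summable w ∧
    Orthonormal ℝ e ∧ Orthonormal ℝ f ∧ HasSum (fun j => w j • outer (e j) (f j)) k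

/-- The operator with kernel `k` is self-adjoint and positive semi-definite
(note that `⟨F f, g⟩ = ⟨k, g ⊗ f⟩`). -/
def IsPSD (k : L2 (α × α)) : Prop :=
  (∀ f g : L2 α, inner ℝ k (outer g f) = inner ℝ k (outer f g)) ∧
    ∀ f : L2 α, 0 ≤ inner ℝ k (outer f f)

end Schatten

/-! ## Tensor products of operators -/

lemma measurePreserving_regroup :
    MeasurePreserving
      (fun p : (I × I) × (I × I) => ((p.1.1, p.2.1), (p.1.2, p.2.2))) volume volume := by
  have h1 : MeasurePreserving
      (fun p : I × (I × I) => (p.2.1, (p.1, p.2.2))) volume volume := by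
    have e1 := (measurePreserving_prodAssoc (volume : Measure I) (volume : Measure I)
      (volume : Measure I)).symm
    have e2 := (Measure.measurePreserving_swap (μ := (volume : Measure I))
      (ν := (volume : Measure I))).prod (MeasurePreserving.id (volume : Measure I))
    have e3 := measurePreserving_prodAssoc (volume : Measure I) (volume : Measure I)
      (volume : Measure I)
    exact e3.comp (e2.comp e1)
  have e1 := measurePreserving_prodAssoc (volume : Measure I) (volume : Measure I)
    (volume : Measure (I × I))
  have e2 := (MeasurePreserving.id (volume : Measure I)).prod h1
  have e3 := (measurePreserving_prodAssoc (volume : Measure I) (volume : Measure I)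
    (volume : Measure (I × I))).symm
  exact e3.comp (e2.comp e1)

/-- The regrouping of variables `k((t, t'), (s, s')) ↦ k((t, s), (t', s'))`. -/
def regroup : L2 ((I × I) × (I × I)) →ₗᵢ[ℝ] SurfaceOp :=
  Lp.compMeasurePreservingₗᵢ ℝ _ measurePreserving_regroup

/-- The tensor product of two operators on `L²[0,1]`, an operator on `L²[0,1]²`. Its kernel is
`(a₁ ⊗̃ a₂)((t, s), (t', s')) = a₁(t, t') a₂(s, s')`. -/
def opTensor (a₁ a₂ : CurveOp) : SurfaceOp := regroup (outer a₁ a₂)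

lemma coeFn_opTensor (a₁ a₂ : CurveOp) : opTensor a₁ a₂ =ᵐ[volume]
    fun p => a₁ (p.1.1, p.2.1) * a₂ (p.1.2, p.2.2) := by
  have h1 : opTensor a₁ a₂ =ᵐ[volume] outer a₁ a₂ ∘ _ :=
    Lp.coeFn_compMeasurePreserving (outer a₁ a₂) measurePreserving_regroup
  have h2 := measurePreserving_regroup.quasiMeasurePreserving.ae (coeFn_outer a₁ a₂)
  filter_upwards [h1, h2] with p h3 h4
  rw [h3, Function.comp_apply, h4]

/-- The kernel `(t, t') ↦ ∫∫ k((t, s), (t', s')) c(s, s') ds ds'`, as the adjoint of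
`a ↦ a ⊗̃ c`. -/
def contractSnd (c : CurveOp) : SurfaceOp →L[ℝ] CurveOp :=
  ContinuousLinearMap.adjoint
    (regroup.toContinuousLinearMap ∘L (outerL (α := I × I) (β := I × I)).flip c)

/-- The kernel `(s, s') ↦ ∫∫ k((t, s), (t', s')) c(t, t') dt dt'`, as the adjoint of
`a ↦ c ⊗̃ a`. -/
def contractFst (c : CurveOp) : SurfaceOp →L[ℝ] CurveOp :=
  ContinuousLinearMap.adjoint
    (regroup.toContinuousLinearMap ∘L outerL (α := I × I) (β := I × I) c)

lemma inner_contractSnd (c a : CurveOp) (k : SurfaceOp) :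
    inner ℝ (contractSnd c k) a = inner ℝ k (opTensor a c) := by
  rw [contractSnd, ContinuousLinearMap.adjoint_inner_left]
  rfl

lemma inner_contractFst (c a : CurveOp) (k : SurfaceOp) :
    inner ℝ (contractFst c k) a = inner ℝ k (opTensor c a) := by
  rw [contractFst, ContinuousLinearMap.adjoint_inner_left]
  rfl

/-! ## Shifted partial tracing -/

/-- Extension of a function on `[0,1]` by zero. -/
def extZero (f : I → ℝ) (x : ℝ) : ℝ := if h : x ∈ I then f ⟨x, h⟩ else 0

lemma memLp_shift (δ : ℝ) (f : Curve) :
    MemLp (fun s : I => extZero f (s - δ)) 2 volume := by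
  have hemb := unitInterval.measurableEmbedding_coe
  have hmap : Measure.map ((↑) : I → ℝ) volume = volume.restrict I :=
    unitInterval.measurePreserving_coe.map_eq
  have hcomp : (extZero f) ∘ ((↑) : I → ℝ) = f := by
    funext s
    simp [extZero]
  have h1 : MemLp (extZero f) 2 (volume.restrict I) := by
    rw [← hmap, hemb.memLp_map_measure_iff, hcomp]
    exact Lp.memLp f
  have hind : Set.indicator I (extZero f) = extZero f := by
    funext x
    by_cases hx : x ∈ I
    · simp only [Set.indicator_of_mem hx]
    · rw [Set.indicator_of_notMem hx, extZero, dif_neg hx]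
  have h2 : MemLp (extZero f) 2 volume := by
    rw [← hind]
    exact (memLp_indicator_iff_restrict measurableSet_Icc).2 h1
  have h3 : MemLp (fun x : ℝ => extZero f (x - δ)) 2 volume :=
    h2.comp_measurePreserving (measurePreserving_sub_right volume δ)
  have h4 : MemLp (fun x : ℝ => extZero f (x - δ)) 2 (Measure.map ((↑) : I → ℝ) volume) := by
    rw [hmap]
    exact h3.restrict _
  exact (hemb.memLp_map_measure_iff).1 h4

/-- The shift `(U f)(s) = f(s - δ)`, with `f` extended by zero. For an operator `F` with kernel
`k(t, s)` the operator `F U` has the kernel `k(t, s + δ)`, set to zero for `s > 1 - δ`. -/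
def shift (δ : ℝ) (f : Curve) : Curve := (memLp_shift δ f).toLp _

/-- The index set of an orthonormal basis of `L²[0,1]`. -/
def basisIndex : Set Curve := (exists_hilbertBasis ℝ Curve).choose

/-- An orthonormal basis of `L²[0,1]`, used to evaluate traces; the choice is immaterial for
trace-class operators. -/
def basis : HilbertBasis basisIndex ℝ Curve :=
  (exists_hilbertBasis ℝ Curve).choose_spec.choose

/-- `eⱼ ⊗ U eⱼ` for a basis function `eⱼ`; the shifted trace of an operator on `L²[0,1]` with
kernel `k` is `∑ⱼ ⟨k, eⱼ ⊗ U eⱼ⟩`, which is `∫ k(t, t + δ) dt` over `[0, 1 - δ]` if `k` is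
continuous. -/
def shiftedDiag (δ : ℝ) (j : basisIndex) : CurveOp := outer (basis j) (shift δ (basis j))

/-- The shifted trace of a trace-class operator on `L²[0,1]²`: the trace of the operator with
kernel `c((t, s), (t' + δ, s' + δ))`, evaluated in the orthonormal basis `eᵢ ⊗ eⱼ`. For
continuous `c` it is `∫∫ c((t, s), (t + δ, s + δ)) dt ds` over `[0, 1 - δ]²`. -/
def shiftedTrace (δ : ℝ) (c : SurfaceOp) : ℝ :=
  ∑' ij : basisIndex × basisIndex,
    inner ℝ c (opTensor (shiftedDiag δ ij.1) (shiftedDiag δ ij.2))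

/-- The first shifted partial trace: the partial trace over the second variable of the operator
with kernel `c((t, s), (t', s' + δ))`. For continuous `c` its kernel is
`(t, t') ↦ ∫ c((t, s), (t', s + δ)) ds` over `[0, 1 - δ]`. -/
def shiftedPartialTrace₁ (δ : ℝ) (c : SurfaceOp) : CurveOp :=
  ∑' j : basisIndex, contractSnd (shiftedDiag δ j) c

/-- The second shifted partial trace: the partial trace over the first variable of the operator
with kernel `c((t, s), (t' + δ, s'))`. For continuous `c` its kernel is
`(s, s') ↦ ∫ c((t, s), (t + δ, s')) dt` over `[0, 1 - δ]`. -/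
def shiftedPartialTrace₂ (δ : ℝ) (c : SurfaceOp) : CurveOp :=
  ∑' j : basisIndex, contractFst (shiftedDiag δ j) c

/-! ## Banded and stationary operators, Toeplitz averaging -/

/-- `b` is banded by `δ`: it vanishes almost everywhere on `{max(|t - t'|, |s - s'|) ≥ δ}`. -/
def IsBanded (δ : ℝ) (b : SurfaceOp) : Prop :=
  ∀ᵐ p : (I × I) × (I × I),
    δ ≤ max |(p.1.1 : ℝ) - p.2.1| |(p.1.2 : ℝ) - p.2.2| → b p = 0

/-- The stationary operators: those with a translation-invariant kernel
`b((t, s), (t', s')) = ς(|t - t'|, |s - s'|)`. -/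
def stationary : Submodule ℝ SurfaceOp where
  carrier := {b | ∃ ς : ℝ × ℝ → ℝ, Measurable ς ∧ ∀ᵐ p : (I × I) × (I × I),
    b p = ς (|(p.1.1 : ℝ) - p.2.1|, |(p.1.2 : ℝ) - p.2.2|)}
  add_mem' := by
    rintro b b' ⟨ς, hm, h⟩ ⟨ς', hm', h'⟩
    refine ⟨ς + ς', hm.add hm', ?_⟩
    filter_upwards [h, h', Lp.coeFn_add b b'] with p h1 h2 h3
    rw [h3, Pi.add_apply, h1, h2, Pi.add_apply]
  zero_mem' := by
    refine ⟨0, measurable_zero, ?_⟩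
    filter_upwards [Lp.coeFn_zero ℝ 2 (volume : Measure ((I × I) × (I × I)))] with p h
    rw [h]
    rfl
  smul_mem' := by
    rintro r b ⟨ς, hm, h⟩
    refine ⟨r • ς, hm.const_smul r, ?_⟩
    filter_upwards [h, Lp.coeFn_smul r b] with p h1 h2
    rw [h2, Pi.smul_apply, h1, Pi.smul_apply]

/-- Toeplitz averaging: the orthogonal projection, in the Hilbert-Schmidt inner product, onto the
(closed) subspace of stationary operators. -/
def toeplitzAvg : SurfaceOp →L[ℝ] SurfaceOp :=
  stationary.topologicalClosure.starProjection

/-! ## The estimators -/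

/-- The separable part `A₁(δ) ⊗̃ A₂(δ)` extracted from `c` by shifted partial tracing, where
`A₁(δ) = Tr₁(c)` and `A₂(δ) = Tr₂(c) / Tr(c)`. -/
def separablePart (δ : ℝ) (c : SurfaceOp) : SurfaceOp :=
  opTensor (shiftedPartialTrace₁ δ c) ((shiftedTrace δ c)⁻¹ • shiftedPartialTrace₂ δ c)

/-- The stationary part `B(δ) = Ta(c - A₁(δ) ⊗̃ A₂(δ))`. -/
def bandedPart (δ : ℝ) (c : SurfaceOp) : SurfaceOp := toeplitzAvg (c - separablePart δ c)

/-- The separable-plus-banded proxy `C(δ) = A₁(δ) ⊗̃ A₂(δ) + B(δ)` of `c`. -/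
def proxy (δ : ℝ) (c : SurfaceOp) : SurfaceOp := separablePart δ c + bandedPart δ c

/-- The mean of the surfaces `xₙ`, `n ∈ S`. -/
def sampleMean (x : ℕ → Surface) (S : Finset ℕ) : Surface :=
  (S.card : ℝ)⁻¹ • ∑ n ∈ S, x n

/-- The empirical covariance of the surfaces `xₙ`, `n ∈ S`. -/
def empCov (x : ℕ → Surface) (S : Finset ℕ) : SurfaceOp :=
  (S.card : ℝ)⁻¹ • ∑ n ∈ S, outer (x n - sampleMean x S) (x n - sampleMean x S)

/-- The leave-one-out cross-validation criterion
`‖Ĉ(δ)‖² - (2/N) ∑ₙ ⟨xₙ, Ĉ₋ₙ(δ) xₙ⟩` for the sample `x₀, …, x_{N-1}`, where `Ĉ₋ₙ(δ)` is the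
estimator constructed without `xₙ`. -/
def cvCriterion (x : ℕ → Surface) (N : ℕ) (δ : ℝ) : ℝ :=
  ‖proxy δ (empCov x (Finset.range N))‖ ^ 2 -
    2 / (N : ℝ) * ∑ n ∈ Finset.range N,
      inner ℝ (proxy δ (empCov x ((Finset.range N).erase n))) (outer (x n) (x n))

/-- The theoretical criterion `‖C(δ) - C‖²`. -/
def theoreticalCriterion (c : SurfaceOp) (δ : ℝ) : ℝ := ‖proxy δ c - c‖ ^ 2

/-- The set of minimisers of `f` over the grid `Δ`. -/
def argminOn (Δ : Finset ℝ) (f : ℝ → ℝ) : Set ℝ := {δ | δ ∈ Δ ∧ ∀ δ' ∈ Δ, f δ ≤ f δ'}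

/-! ## Probability -/

section Probability

variable {Ω : Type*} [MeasurableSpace Ω]

/-- The covariance `E[(X - EX) ⊗ (X - EX)]` of a random surface. -/
def covariance (P : Measure Ω) (X : Ω → Surface) : SurfaceOp :=
  ∫ ω, outer (X ω - ∫ ω', X ω' ∂P) (X ω - ∫ ω', X ω' ∂P) ∂P

/-- The moment condition `∑ⱼ (E ⟨X, eⱼ⟩⁴)^{1/4} < ∞` for some orthonormal basis `(eⱼ)` of
`L²[0,1]²`. -/
def MomentCondition (P : Measure Ω) (X : Ω → Surface) : Prop :=
  ∃ e : HilbertBasis ℕ ℝ Surface,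
    ∑' j, eLpNorm (fun ω => (inner ℝ (X ω) (e j) : ℝ)) 4 P < ∞

/-- `R_N = O_P(r_N)` as `N → ∞`. -/
def IsBigOInProbability (P : Measure Ω) (R : ℕ → Ω → ℝ) (r : ℕ → ℝ) : Prop :=
  ∀ ε : ℝ, 0 < ε → ∃ M : ℝ, 0 < M ∧
    ∀ᶠ N in atTop, P {ω | M * r N < |R N ω|} ≤ ENNReal.ofReal ε

end Probability

end SepBand

end

/-!
The stationary part `B` is banded by `δstar`, so it is invisible to the shifted (partial) traces
with `δ ≥ δstar`: these depend only on the values of the kernel on the shifted diagonals, where `B`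
vanishes. Hence the separable part of `A₁ ⊗̃ A₂ + B` at such a `δ` is exactly `A₁ ⊗̃ A₂`. Shifted
traces are bounded by the nuclear norm, which makes the two estimators locally Lipschitz functions
of the covariance in that norm.

The nuclear norm is dominated by the `ℓ¹` norm of the coefficients in the basis of the moment
condition. In the latter norm the moment condition gives the rate `N^{-1/2}` for the empirical
covariance, and leaving out one observation is harmless, because every `‖Xₙ‖²` is `o(N)` uniformly
in `n < N`, with high probability. The cross-validation criterion then converges to
`Ξ(δ) - ‖C‖²` uniformly over the grid, so with high probability its minimiser minimises `Ξ` as well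
and is at least `δstar`; on that event the Lipschitz estimates transfer the rate.
-/

noncomputable section

namespace SepBand

open scoped InnerProductSpace NNReal

lemma tsum_mul_le_of_tsum_sq_le {ι : Type*} {f g : ι → ℝ≥0∞} {A B : ℝ≥0∞}
    (hf : ∑' i, f i ^ 2 ≤ A ^ 2) (hg : ∑' i, g i ^ 2 ≤ B ^ 2) : ∑' i, f i * g i ≤ A * B := by
  have sqrt_sum_le {f : ι → ℝ≥0∞} {A : ℝ≥0∞} (h : ∑' i, f i ^ 2 ≤ A ^ 2) (s : Finset ι) :
      (∑ i ∈ s, f i ^ (2 : ℝ)) ^ (1 / (2 : ℝ)) ≤ A := by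
    rw [one_div, ENNReal.rpow_inv_le_iff two_pos]
    simpa only [ENNReal.rpow_two] using (ENNReal.sum_le_tsum s).trans h
  exact ENNReal.summable.tsum_le_of_sum_le fun s =>
    (ENNReal.inner_le_Lp_mul_Lq s f g Real.HolderConjugate.two_two).trans
      (mul_le_mul' (sqrt_sum_le hf s) (sqrt_sum_le hg s))

section Hilbert

variable {ι H K : Type*} [NormedAddCommGroup H] [InnerProductSpace ℝ H]
  [NormedAddCommGroup K] [InnerProductSpace ℝ K]

lemma tsum_enorm_inner_sq (b : HilbertBasis ι ℝ H) (x : H) :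
    ∑' i, ‖⟪x, b i⟫_ℝ‖ₑ ^ 2 = ‖x‖ₑ ^ 2 := by
  have h : HasSum (fun i => ⟪x, b i⟫_ℝ ^ 2) (‖x‖ ^ 2) := by
    simpa only [pow_two, ← real_inner_self_eq_norm_mul_norm, real_inner_comm x (b _)]
      using b.hasSum_inner_mul_inner x x
  simp only [Real.enorm_eq_ofReal_abs, ← ENNReal.ofReal_pow (abs_nonneg _), sq_abs]
  rw [← ENNReal.ofReal_tsum_of_nonneg (fun _ => sq_nonneg _) h.summable, h.tsum_eq,
    ENNReal.ofReal_pow (norm_nonneg _), ofReal_norm]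

/-- A Bessel family with bound `1`. Both an orthonormal basis and its image under a contraction are
of this kind, and this is all that the estimates for shifted traces use. -/
def IsBessel (f : ι → H) : Prop := ∀ x, ∑' i, ‖⟪x, f i⟫_ℝ‖ₑ ^ 2 ≤ ‖x‖ₑ ^ 2

lemma isBessel_of_orthonormal {f : ι → H} (hf : Orthonormal ℝ f) : IsBessel f := fun x => by
  refine ENNReal.summable.tsum_le_of_sum_le fun s => ?_
  have h := ENNReal.ofReal_le_ofReal (hf.sum_inner_products_le (s := s) x)
  rw [ENNReal.ofReal_sum_of_nonneg fun _ _ => sq_nonneg _] at h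
  simpa only [ENNReal.ofReal_pow (norm_nonneg _), ofReal_norm, ← real_inner_comm x] using h

lemma isBessel_map_hilbertBasis [CompleteSpace H] [CompleteSpace K]
    (b : HilbertBasis ι ℝ H) {V : H →L[ℝ] K} (hV : ‖V‖ ≤ 1) :
    IsBessel fun i => V (b i) := fun x => by
  simp_rw [← ContinuousLinearMap.adjoint_inner_left]
  rw [tsum_enorm_inner_sq]
  gcongr
  rw [enorm_le_iff_norm_le]
  refine ((ContinuousLinearMap.adjoint V).le_opNorm x).trans ?_
  rw [LinearIsometryEquiv.norm_map]
  exact mul_le_of_le_one_left (norm_nonneg _) hV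

lemma IsBessel.tsum_enorm_inner_mul_inner_le {f : ι → H} {g : ι → K} (hf : IsBessel f)
    (hg : IsBessel g) (x : H) (y : K) :
    ∑' i, ‖⟪x, f i⟫_ℝ‖ₑ * ‖⟪y, g i⟫_ℝ‖ₑ ≤ ‖x‖ₑ * ‖y‖ₑ :=
  tsum_mul_le_of_tsum_sq_le (hf x) (hg y)

end Hilbert

section Outer

variable {α β : Type*} [MeasureSpace α] [MeasureSpace β]

lemma setIntegral_prod_eq_inner_outer [IsFiniteMeasure (volume : Measure α)]
    [IsFiniteMeasure (volume : Measure β)] (k : L2 (α × β)) {s : Set α} {t : Set β}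
    (hs : MeasurableSet s) (ht : MeasurableSet t) :
    ∫ p in s ×ˢ t, k p = ⟪k, outer (indicatorConstLp 2 hs (measure_ne_top volume s) 1)
      (indicatorConstLp 2 ht (measure_ne_top volume t) 1)⟫_ℝ := by
  rw [L2.inner_def, ← integral_indicator (hs.prod ht)]
  have h1 : ∀ᵐ p : α × β, indicatorConstLp 2 hs (measure_ne_top volume s) (1 : ℝ) p.1 =
      s.indicator (fun _ => 1) p.1 := Measure.quasiMeasurePreserving_fst.ae indicatorConstLp_coeFn
  have h2 : ∀ᵐ p : α × β, indicatorConstLp 2 ht (measure_ne_top volume t) (1 : ℝ) p.2 =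
      t.indicator (fun _ => 1) p.2 := Measure.quasiMeasurePreserving_snd.ae indicatorConstLp_coeFn
  refine integral_congr_ae ?_
  filter_upwards [coeFn_outer (indicatorConstLp 2 hs (measure_ne_top volume s) (1 : ℝ))
    (indicatorConstLp 2 ht (measure_ne_top volume t) (1 : ℝ)), h1, h2] with p h3 h4 h5
  rw [h3, h4, h5]
  by_cases hps : p.1 ∈ s <;> by_cases hpt : p.2 ∈ t <;> simp [Set.indicator, hps, hpt]

lemma eq_zero_of_forall_inner_outer_eq_zero [IsFiniteMeasure (volume : Measure α)]
    [IsFiniteMeasure (volume : Measure β)] {k : L2 (α × β)}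
    (h : ∀ f g, ⟪k, outer f g⟫_ℝ = 0) : k = 0 := by
  have hint : Integrable k volume := (Lp.memLp k).integrable (by norm_num)
  have hrect {s : Set α} {t : Set β} (hs : MeasurableSet s) (ht : MeasurableSet t) :
      ∫ p in s ×ˢ t, k p = 0 := by
    rw [setIntegral_prod_eq_inner_outer k hs ht, h]
  rw [Lp.eq_zero_iff_ae_eq_zero]
  refine hint.ae_eq_zero_of_forall_setIntegral_eq_zero fun s hs _ => ?_
  induction s, hs using MeasurableSpace.induction_on_inter generateFrom_prod.symm
    isPiSystem_prod with
  | empty => simp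
  | basic u hu =>
    obtain ⟨s, hs, t, ht, rfl⟩ := hu
    exact hrect hs ht
  | compl u hu ih =>
    rw [setIntegral_compl hu hint, ih (measure_lt_top _ _), sub_zero, ← setIntegral_univ,
      ← Set.univ_prod_univ, hrect MeasurableSet.univ MeasurableSet.univ]
  | iUnion f hd hf ih =>
    rw [integral_iUnion hf hd hint.integrableOn]
    simp only [ih _ (measure_lt_top _ _), tsum_zero]

lemma ext_inner_outer [IsFiniteMeasure (volume : Measure α)]
    [IsFiniteMeasure (volume : Measure β)] {k l : L2 (α × β)}
    (h : ∀ f g, ⟪k, outer f g⟫_ℝ = ⟪l, outer f g⟫_ℝ) : k = l :=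
  sub_eq_zero.1 <| eq_zero_of_forall_inner_outer_eq_zero fun f g => by
    rw [inner_sub_left, h, sub_self]

variable [SFinite (volume : Measure α)] [SFinite (volume : Measure β)]

@[simp]
lemma outerL_apply (x : L2 α) (y : L2 β) : outerL x y = outer x y := rfl

lemma enorm_outer (x : L2 α) (y : L2 β) : ‖outer x y‖ₑ = ‖x‖ₑ * ‖y‖ₑ := by
  rw [← enorm_norm, norm_outer, enorm_mul, enorm_norm, enorm_norm]

lemma inner_outer_outer (x x' : L2 α) (y y' : L2 β) :
    ⟪outer x y, outer x' y'⟫_ℝ = ⟪x, x'⟫_ℝ * ⟪y, y'⟫_ℝ := by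
  simp only [L2.inner_def]
  rw [← integral_prod_mul (μ := volume) (ν := volume) (fun a => ⟪x a, x' a⟫_ℝ)
    (fun b => ⟪y b, y' b⟫_ℝ)]
  refine integral_congr_ae ?_
  filter_upwards [coeFn_outer x y, coeFn_outer x' y'] with p hp hp'
  rw [hp, hp']
  simp only [RCLike.inner_apply, conj_trivial]
  ring

/-- The partial inner product `q ↦ ∫ u(p) x(p, q) dp`, as the adjoint of `g ↦ u ⊗ g`. -/
def sliceFst (u : L2 α) : L2 (α × β) →L[ℝ] L2 β := ContinuousLinearMap.adjoint (outerL u)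

/-- The partial inner product `p ↦ ∫ v(q) x(p, q) dq`, as the adjoint of `f ↦ f ⊗ v`. -/
def sliceSnd (v : L2 β) : L2 (α × β) →L[ℝ] L2 α := ContinuousLinearMap.adjoint (outerL.flip v)

lemma inner_sliceFst (u : L2 α) (g : L2 β) (x : L2 (α × β)) :
    ⟪sliceFst u x, g⟫_ℝ = ⟪x, outer u g⟫_ℝ := by
  rw [sliceFst, ContinuousLinearMap.adjoint_inner_left, outerL_apply]

lemma inner_sliceSnd (v : L2 β) (f : L2 α) (x : L2 (α × β)) :
    ⟪sliceSnd v x, f⟫_ℝ = ⟪x, outer f v⟫_ℝ := by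
  rw [sliceSnd, ContinuousLinearMap.adjoint_inner_left, ContinuousLinearMap.flip_apply,
    outerL_apply]

lemma norm_sliceFst_le (u : L2 α) (x : L2 (α × β)) : ‖sliceFst u x‖ ≤ ‖u‖ * ‖x‖ := by
  refine ((sliceFst u).le_opNorm x).trans ?_
  gcongr
  rw [sliceFst, LinearIsometryEquiv.norm_map]
  refine ContinuousLinearMap.opNorm_le_bound _ (norm_nonneg _) fun y => ?_
  rw [outerL_apply, norm_outer]

variable {ι κ : Type*}

lemma orthonormal_outer {b : ι → L2 α} {c : κ → L2 β} (hb : Orthonormal ℝ b)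
    (hc : Orthonormal ℝ c) : Orthonormal ℝ (fun p : ι × κ => outer (b p.1) (c p.2)) := by
  classical
  rw [orthonormal_iff_ite] at *
  rintro ⟨i, j⟩ ⟨i', j'⟩
  rw [inner_outer_outer, hb, hc]
  by_cases h : i = i' <;> by_cases h' : j = j' <;> simp [h, h']

lemma IsBessel.tsum_enorm_sliceSnd_sq_le {g : κ → L2 β} (hg : IsBessel g) (x : L2 (α × β)) :
    ∑' j, ‖sliceSnd (g j) x‖ₑ ^ 2 ≤ ‖x‖ₑ ^ 2 := by
  obtain ⟨_, b, -⟩ := exists_hilbertBasis ℝ (L2 α)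
  obtain ⟨_, c, -⟩ := exists_hilbertBasis ℝ (L2 β)
  calc ∑' j, ‖sliceSnd (g j) x‖ₑ ^ 2 = ∑' j, ∑' i, ‖⟪sliceFst (b i) x, g j⟫_ℝ‖ₑ ^ 2 := by
        simp only [← tsum_enorm_inner_sq b, inner_sliceSnd, inner_sliceFst]
    _ = ∑' i, ∑' j, ‖⟪sliceFst (b i) x, g j⟫_ℝ‖ₑ ^ 2 := ENNReal.tsum_comm
    _ ≤ ∑' i, ‖sliceFst (b i) x‖ₑ ^ 2 := by gcongr with i; exact hg _
    _ = ∑' p : _ × _, ‖⟪x, outer (b p.1) (c p.2)⟫_ℝ‖ₑ ^ 2 := by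
        simp only [← tsum_enorm_inner_sq c, inner_sliceFst, ENNReal.tsum_prod']
    _ ≤ ‖x‖ₑ ^ 2 := isBessel_of_orthonormal (orthonormal_outer b.orthonormal c.orthonormal) x

lemma IsBessel.outer {f : ι → L2 α} {g : κ → L2 β} (hf : IsBessel f) (hg : IsBessel g) :
    IsBessel fun p : ι × κ => SepBand.outer (f p.1) (g p.2) := fun x =>
  calc ∑' p : ι × κ, ‖⟪x, SepBand.outer (f p.1) (g p.2)⟫_ℝ‖ₑ ^ 2
      = ∑' j, ∑' i, ‖⟪sliceSnd (g j) x, f i⟫_ℝ‖ₑ ^ 2 := by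
        simp only [inner_sliceSnd, ENNReal.tsum_prod']
        exact ENNReal.tsum_comm
    _ ≤ ∑' j, ‖sliceSnd (g j) x‖ₑ ^ 2 := by gcongr with j; exact hf _
    _ ≤ ‖x‖ₑ ^ 2 := hg.tsum_enorm_sliceSnd_sq_le x

end Outer

section OuterBasis

variable {α β ι κ : Type*} [MeasureSpace α] [MeasureSpace β]
  [IsFiniteMeasure (volume : Measure α)] [IsFiniteMeasure (volume : Measure β)]

/-- The tensor product of two orthonormal bases. -/
def outerBasis (b : HilbertBasis ι ℝ (L2 α)) (c : HilbertBasis κ ℝ (L2 β)) :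
    HilbertBasis (ι × κ) ℝ (L2 (α × β)) :=
  HilbertBasis.mkOfOrthogonalEqBot (orthonormal_outer b.orthonormal c.orthonormal) <| by
    rw [Submodule.eq_bot_iff]
    intro k hk
    have hcoeff (i j) : ⟪k, outer (b i) (c j)⟫_ℝ = 0 :=
      Submodule.inner_left_of_mem_orthogonal
        (Submodule.subset_span (Set.mem_range_self (i, j))) hk
    have hFst (i) : sliceFst (b i) k = 0 := by
      rw [← enorm_eq_zero, ← pow_eq_zero_iff two_ne_zero, ← tsum_enorm_inner_sq c]
      simp [inner_sliceFst, hcoeff]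
    have hSnd (g) : sliceSnd g k = 0 := by
      rw [← enorm_eq_zero, ← pow_eq_zero_iff two_ne_zero, ← tsum_enorm_inner_sq b]
      simp [inner_sliceSnd, ← inner_sliceFst, hFst]
    exact eq_zero_of_forall_inner_outer_eq_zero fun f g => by
      rw [← inner_sliceSnd, hSnd, inner_zero_left]

@[simp]
lemma outerBasis_apply (b : HilbertBasis ι ℝ (L2 α)) (c : HilbertBasis κ ℝ (L2 β)) (p : ι × κ) :
    outerBasis b c p = outer (b p.1) (c p.2) := by
  rw [outerBasis, HilbertBasis.coe_mkOfOrthogonalEqBot]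

end OuterBasis

section OpTensor

lemma opTensor_outer_outer (f g u v : Curve) :
    opTensor (outer f g) (outer u v) = outer (outer f u) (outer g v) := by
  apply Lp.ext
  have hregroup := measurePreserving_regroup.quasiMeasurePreserving
  have h1 : ∀ᵐ p : (I × I) × (I × I), outer f g (p.1.1, p.2.1) = f p.1.1 * g p.2.1 :=
    (Measure.quasiMeasurePreserving_fst.comp hregroup).ae (coeFn_outer f g)
  have h2 : ∀ᵐ p : (I × I) × (I × I), outer u v (p.1.2, p.2.2) = u p.1.2 * v p.2.2 :=
    (Measure.quasiMeasurePreserving_snd.comp hregroup).ae (coeFn_outer u v)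
  have h3 : ∀ᵐ p : (I × I) × (I × I), outer f u p.1 = f p.1.1 * u p.1.2 :=
    Measure.quasiMeasurePreserving_fst.ae (coeFn_outer f u)
  have h4 : ∀ᵐ p : (I × I) × (I × I), outer g v p.2 = g p.2.1 * v p.2.2 :=
    Measure.quasiMeasurePreserving_snd.ae (coeFn_outer g v)
  filter_upwards [coeFn_opTensor (outer f g) (outer u v), h1, h2, h3, h4,
    coeFn_outer (outer f u) (outer g v)] with p h5 h6 h7 h8 h9 h10
  rw [h5, h6, h7, h10, h8, h9]
  ring

/-- `opTensor` as a bounded bilinear map. -/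
def opTensorL : CurveOp →L[ℝ] CurveOp →L[ℝ] SurfaceOp :=
  (ContinuousLinearMap.compL ℝ _ _ _ regroup.toContinuousLinearMap) ∘L outerL

@[simp]
lemma opTensorL_apply (a b : CurveOp) : opTensorL a b = opTensor a b := rfl

lemma inner_opTensor_opTensor (a b a' b' : CurveOp) :
    ⟪opTensor a b, opTensor a' b'⟫_ℝ = ⟪a, a'⟫_ℝ * ⟪b, b'⟫_ℝ := by
  rw [opTensor, opTensor, LinearIsometry.inner_map_map, inner_outer_outer]

lemma contractSnd_outer_outer (u v : Curve) (x y : Surface) :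
    contractSnd (outer u v) (outer x y) = outer (sliceSnd u x) (sliceSnd v y) :=
  ext_inner_outer fun f g => by
    rw [inner_contractSnd, opTensor_outer_outer, inner_outer_outer, inner_outer_outer,
      inner_sliceSnd, inner_sliceSnd]

lemma contractFst_outer_outer (u v : Curve) (x y : Surface) :
    contractFst (outer u v) (outer x y) = outer (sliceFst u x) (sliceFst v y) :=
  ext_inner_outer fun f g => by
    rw [inner_contractFst, opTensor_outer_outer, inner_outer_outer, inner_outer_outer,
      inner_sliceFst, inner_sliceFst]

lemma contractSnd_opTensor (c a b : CurveOp) : contractSnd c (opTensor a b) = ⟪b, c⟫_ℝ • a :=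
  ext_inner_right ℝ fun v => by
    rw [inner_contractSnd, inner_opTensor_opTensor, real_inner_smul_left, mul_comm]

end OpTensor

section Shift

lemma extZero_comp_coe (f : I → ℝ) : extZero f ∘ ((↑) : I → ℝ) = f := by
  funext s
  simp [extZero]

lemma extZero_of_notMem (f : I → ℝ) {x : ℝ} (hx : x ∉ I) : extZero f x = 0 := dif_neg hx

lemma memLp_extZero (f : Curve) : MemLp (extZero f) 2 (volume : Measure ℝ) := by
  have hI : MemLp (extZero f) 2 (volume.restrict I) := by
    rw [← unitInterval.measurePreserving_coe.map_eq,
      unitInterval.measurableEmbedding_coe.memLp_map_measure_iff, extZero_comp_coe]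
    exact Lp.memLp f
  have hind : Set.indicator I (extZero f) = extZero f :=
    Set.indicator_eq_self.2 fun x hx => not_imp_comm.1 (extZero_of_notMem f) hx
  rw [← hind]
  exact (memLp_indicator_iff_restrict measurableSet_Icc).2 hI

/-- Restriction of functions on the line to the unit interval. -/
def restrictL : Lp ℝ 2 (volume : Measure ℝ) →L[ℝ] Curve :=
  (Lp.compMeasurePreservingₗᵢ ℝ _ unitInterval.measurePreserving_coe).toContinuousLinearMap ∘L
    LpToLpRestrictCLM ℝ ℝ ℝ volume 2 I

lemma coeFn_restrictL (g : Lp ℝ 2 (volume : Measure ℝ)) :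
    restrictL g =ᵐ[volume] fun s : I => g s := by
  have h1 : restrictL g =ᵐ[volume] LpToLpRestrictCLM ℝ ℝ ℝ volume 2 I g ∘ ((↑) : I → ℝ) :=
    Lp.coeFn_compMeasurePreserving _ unitInterval.measurePreserving_coe
  have h2 := unitInterval.measurePreserving_coe.quasiMeasurePreserving.ae
    (LpToLpRestrictCLM_coeFn (p := 2) ℝ I g)
  filter_upwards [h1, h2] with s h3 h4
  rw [h3, Function.comp_apply, h4]

lemma norm_restrictL_le : ‖restrictL‖ ≤ 1 :=
  ContinuousLinearMap.opNorm_le_bound _ zero_le_one fun g => by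
    rw [one_mul]
    exact (Lp.norm_compMeasurePreserving _ _).trans_le (norm_Lp_toLp_restrict_le I g)

/-- Extension by zero to the line, as the adjoint of the restriction. -/
def extendL : Curve →L[ℝ] Lp ℝ 2 (volume : Measure ℝ) := ContinuousLinearMap.adjoint restrictL

lemma extendL_apply (f : Curve) : extendL f = (memLp_extZero f).toLp _ := by
  refine ext_inner_right ℝ fun g => ?_
  rw [extendL, ContinuousLinearMap.adjoint_inner_left, L2.inner_def, L2.inner_def]
  calc ∫ s : I, ⟪f s, restrictL g s⟫_ℝ = ∫ s : I, ⟪extZero f s, g s⟫_ℝ := by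
        refine integral_congr_ae ?_
        filter_upwards [coeFn_restrictL g] with s hs
        rw [hs, ← Function.comp_apply (f := extZero f), extZero_comp_coe]
    _ = ∫ x in I, ⟪extZero f x, g x⟫_ℝ :=
        unitInterval.measurePreserving_coe.integral_comp unitInterval.measurableEmbedding_coe
          fun x : ℝ => ⟪extZero f x, g x⟫_ℝ
    _ = ∫ x, ⟪extZero f x, g x⟫_ℝ := setIntegral_eq_integral_of_forall_compl_eq_zero
        fun x hx => by rw [extZero_of_notMem f hx, inner_zero_left]
    _ = ∫ x, ⟪(memLp_extZero f).toLp _ x, g x⟫_ℝ := by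
        refine integral_congr_ae ?_
        filter_upwards [(memLp_extZero f).coeFn_toLp] with x hx
        rw [hx]

/-- The shift as a bounded operator. -/
def shiftL (δ : ℝ) : Curve →L[ℝ] Curve :=
  restrictL ∘L (Lp.compMeasurePreservingₗᵢ ℝ _
    (measurePreserving_sub_right (volume : Measure ℝ) δ)).toContinuousLinearMap ∘L extendL

lemma shiftL_apply (δ : ℝ) (f : Curve) : shiftL δ f = shift δ f := by
  have hδ := measurePreserving_sub_right (volume : Measure ℝ) δ
  have htranslate : shiftL δ f = restrictL (((memLp_extZero f).comp_measurePreserving hδ).toLp _) :=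
    congrArg (fun g => restrictL (Lp.compMeasurePreserving _ hδ g)) (extendL_apply f)
  have hcoe : ∀ᵐ s : I, ((memLp_extZero f).comp_measurePreserving hδ).toLp _ (s : ℝ)
      = extZero f (s - δ) := unitInterval.measurePreserving_coe.quasiMeasurePreserving.ae
    (ae_restrict_of_ae (MemLp.coeFn_toLp _))
  apply Lp.ext
  rw [htranslate]
  filter_upwards [coeFn_restrictL (((memLp_extZero f).comp_measurePreserving hδ).toLp _), hcoe,
    (memLp_shift δ f).coeFn_toLp] with s h1 h2 h3
  rw [h1, h2, shift, h3]

lemma norm_shiftL_le (δ : ℝ) : ‖shiftL δ‖ ≤ 1 := by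
  refine ContinuousLinearMap.opNorm_le_bound _ zero_le_one fun f => ?_
  calc ‖shiftL δ f‖ ≤ 1 * ‖Lp.compMeasurePreserving _
        (measurePreserving_sub_right (volume : Measure ℝ) δ) (extendL f)‖ :=
        restrictL.le_of_opNorm_le norm_restrictL_le _
    _ = ‖extendL f‖ := by rw [one_mul, Lp.norm_compMeasurePreserving]
    _ ≤ 1 * ‖f‖ := extendL.le_of_opNorm_le
        ((LinearIsometryEquiv.norm_map _ _).trans_le norm_restrictL_le) f

lemma continuous_shiftL_apply (f : Curve) : Continuous fun δ => shiftL δ f := by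
  refine restrictL.continuous.comp ?_
  exact Continuous.compMeasurePreservingLp (f := fun _ : ℝ => extendL f)
    (g := fun δ : ℝ => (⟨fun x : ℝ => x - δ, by fun_prop⟩ : C(ℝ, ℝ))) continuous_const
    (ContinuousMap.continuous_of_continuous_uncurry _ (by
      simp only [Function.uncurry_def, ContinuousMap.coe_mk]; fun_prop))
    (fun δ => measurePreserving_sub_right (volume : Measure ℝ) δ) (by norm_num)

end Shift

section Cut

variable {α β : Type*} [MeasureSpace α] [MeasureSpace β]

/-- Multiplication by the indicator function of `S`, as restriction to `S` followed by its adjoint,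
the extension by zero. -/
def cut (S : Set α) : L2 α →L[ℝ] L2 α :=
  ContinuousLinearMap.adjoint (LpToLpRestrictCLM α ℝ ℝ volume 2 S) ∘L
    LpToLpRestrictCLM α ℝ ℝ volume 2 S

lemma inner_cut_left (S : Set α) (f g : L2 α) : ⟪cut S f, g⟫_ℝ = ⟪f, cut S g⟫_ℝ := by
  simp only [cut, ContinuousLinearMap.comp_apply, ContinuousLinearMap.adjoint_inner_left,
    ContinuousLinearMap.adjoint_inner_right]

lemma norm_cut_le (S : Set α) : ‖cut S‖ ≤ 1 := by
  have h : ‖LpToLpRestrictCLM α ℝ ℝ volume 2 S‖ ≤ 1 :=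
    LinearMap.mkContinuous_norm_le _ zero_le_one _
  refine (ContinuousLinearMap.opNorm_comp_le _ _).trans (mul_le_one₀ ?_ (norm_nonneg _) h)
  rwa [LinearIsometryEquiv.norm_map]

lemma coeFn_cut {S : Set α} (hS : MeasurableSet S) (f : L2 α) :
    cut S f =ᵐ[volume] S.indicator f := by
  have hf : MemLp (S.indicator f) 2 volume := (Lp.memLp f).indicator hS
  suffices h : cut S f = hf.toLp _ by rw [h]; exact hf.coeFn_toLp
  refine ext_inner_right ℝ fun g => ?_
  rw [cut, ContinuousLinearMap.comp_apply, ContinuousLinearMap.adjoint_inner_left, L2.inner_def,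
    L2.inner_def]
  calc _ = ∫ a in S, ⟪f a, g a⟫_ℝ := by
        refine integral_congr_ae ?_
        filter_upwards [LpToLpRestrictCLM_coeFn ℝ S f, LpToLpRestrictCLM_coeFn ℝ S g] with a h1 h2
        rw [h1, h2]
    _ = ∫ a, ⟪hf.toLp _ a, g a⟫_ℝ := by
        rw [← integral_indicator hS]
        refine integral_congr_ae ?_
        filter_upwards [hf.coeFn_toLp] with a ha
        by_cases haS : a ∈ S <;> simp [ha, haS]

lemma cut_eq_zero {S : Set α} (hS : MeasurableSet S) {f : L2 α}
    (hf : ∀ᵐ a, a ∈ S → f a = 0) : cut S f = 0 := by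
  rw [Lp.eq_zero_iff_ae_eq_zero]
  filter_upwards [coeFn_cut hS f, hf] with a h1 h2
  rw [h1, Pi.zero_apply, Set.indicator_apply_eq_zero]
  exact h2

lemma cut_eq_self {S : Set α} (hS : MeasurableSet S) {f : L2 α}
    (hf : ∀ᵐ a, a ∉ S → f a = 0) : cut S f = f := by
  apply Lp.ext
  filter_upwards [coeFn_cut hS f, hf] with a h1 h2
  by_cases ha : a ∈ S
  · rw [h1, Set.indicator_of_mem ha]
  · rw [h1, Set.indicator_of_notMem ha, h2 ha]

lemma outer_cut_cut {S : Set α} {T : Set β} (hS : MeasurableSet S) (hT : MeasurableSet T)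
    (x : L2 α) (y : L2 β) : outer (cut S x) (cut T y) = cut (S ×ˢ T) (outer x y) := by
  apply Lp.ext
  have h1 : ∀ᵐ p : α × β, cut S x p.1 = S.indicator x p.1 :=
    Measure.quasiMeasurePreserving_fst.ae (coeFn_cut hS x)
  have h2 : ∀ᵐ p : α × β, cut T y p.2 = T.indicator y p.2 :=
    Measure.quasiMeasurePreserving_snd.ae (coeFn_cut hT y)
  filter_upwards [coeFn_outer (cut S x) (cut T y), coeFn_cut (hS.prod hT) (outer x y),
    coeFn_outer x y, h1, h2] with p h3 h4 h5 h6 h7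
  rw [h3, h4, h6, h7]
  by_cases hp1 : p.1 ∈ S <;> by_cases hp2 : p.2 ∈ T <;> simp [Set.indicator, hp1, hp2, h5]

lemma sum_cut_preimage {γ : Type*} [MeasurableSpace γ] [MeasurableSingletonClass γ] {φ : α → γ}
    (hφ : Measurable φ) {s : Finset γ} (hs : ∀ a, φ a ∈ s) (f : L2 α) :
    ∑ m ∈ s, cut (φ ⁻¹' {m}) f = f := by
  have hcut : ∀ᵐ a, ∀ m ∈ s, cut (φ ⁻¹' {m}) f a = (φ ⁻¹' {m}).indicator f a := by
    rw [eventually_all_finset]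
    exact fun m _ => coeFn_cut (hφ (measurableSet_singleton m)) f
  apply Lp.ext
  filter_upwards [hcut, Lp.coeFn_finsetSum s fun m => cut (φ ⁻¹' {m}) f] with a h1 h2
  rw [h2, Finset.sum_apply, Finset.sum_congr rfl h1, Finset.sum_eq_single_of_mem _ (hs a)]
  · exact Set.indicator_of_mem (s := φ ⁻¹' {φ a}) rfl _
  · exact fun m _ hm => Set.indicator_of_notMem (s := φ ⁻¹' {m}) hm.symm _

lemma measurableSet_translate (δ : ℝ) {J : Set I} (hJ : MeasurableSet J) :
    MeasurableSet {s : I | (s : ℝ) - δ ∈ ((↑) : I → ℝ) '' J} :=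
  (unitInterval.measurableEmbedding_coe.measurableSet_image' hJ).preimage (by fun_prop)

lemma shiftL_cut (δ : ℝ) {J : Set I} (hJ : MeasurableSet J) (f : Curve) :
    cut {s : I | (s : ℝ) - δ ∈ ((↑) : I → ℝ) '' J} (shiftL δ (cut J f)) = shiftL δ (cut J f) := by
  have hline : ∀ᵐ x : ℝ, ∀ hx : x ∈ I, cut J f ⟨x, hx⟩ = J.indicator f ⟨x, hx⟩ := by
    have hI : ∀ᵐ x ∂volume.restrict I, ∀ hx : x ∈ I, cut J f ⟨x, hx⟩ = J.indicator f ⟨x, hx⟩ := by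
      rw [← unitInterval.measurePreserving_coe.map_eq,
        unitInterval.measurableEmbedding_coe.ae_map_iff]
      filter_upwards [coeFn_cut hJ f] with s hs _
      exact hs
    filter_upwards [ae_imp_of_ae_restrict hI] with x hx hxI
    exact hx hxI hxI
  have hshift : ∀ᵐ s : I, ∀ hs : (s : ℝ) - δ ∈ I,
      cut J f ⟨s - δ, hs⟩ = J.indicator f ⟨s - δ, hs⟩ :=
    unitInterval.measurePreserving_coe.quasiMeasurePreserving.ae <| ae_restrict_of_ae <|
      (measurePreserving_sub_right (volume : Measure ℝ) δ).quasiMeasurePreserving.ae hline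
  refine cut_eq_self (measurableSet_translate δ hJ) ?_
  rw [shiftL_apply]
  filter_upwards [(memLp_shift δ (cut J f)).coeFn_toLp, hshift] with s h1 h2 hs
  rw [shift, h1, extZero]
  split_ifs with hI
  · rw [h2 hI, Set.indicator_of_notMem fun hJs => hs ⟨_, hJs, rfl⟩]
  · rfl

end Cut

section Swap

/-- The exchange of variables `x(t, s) ↦ x(s, t)`. -/
def swapSurface : Surface →ₗᵢ[ℝ] Surface :=
  Lp.compMeasurePreservingₗᵢ ℝ _
    (Measure.measurePreserving_swap (μ := (volume : Measure I)) (ν := (volume : Measure I)))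

lemma measurePreserving_swap_swap :
    MeasurePreserving (Prod.map Prod.swap Prod.swap : (I × I) × (I × I) → (I × I) × (I × I))
      volume volume :=
  (Measure.measurePreserving_swap (μ := (volume : Measure I)) (ν := (volume : Measure I))).prod
    (Measure.measurePreserving_swap (μ := (volume : Measure I)) (ν := (volume : Measure I)))

/-- The exchange of variables `k((t, s), (t', s')) ↦ k((s, t), (s', t'))`. It turns statements about
the first shifted partial trace into statements about the second one. -/
def swapOp : SurfaceOp →ₗᵢ[ℝ] SurfaceOp :=
  Lp.compMeasurePreservingₗᵢ ℝ _ measurePreserving_swap_swap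

lemma coeFn_swapSurface (x : Surface) : swapSurface x =ᵐ[volume] x ∘ Prod.swap :=
  Lp.coeFn_compMeasurePreserving x _

lemma coeFn_swapOp (k : SurfaceOp) : swapOp k =ᵐ[volume] k ∘ Prod.map Prod.swap Prod.swap :=
  Lp.coeFn_compMeasurePreserving k measurePreserving_swap_swap

lemma swapOp_outer (x y : Surface) :
    swapOp (outer x y) = outer (swapSurface x) (swapSurface y) := by
  apply Lp.ext
  have h1 := measurePreserving_swap_swap.quasiMeasurePreserving.ae (coeFn_outer x y)
  have h2 : ∀ᵐ p : (I × I) × (I × I), swapSurface x p.1 = x p.1.swap :=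
    Measure.quasiMeasurePreserving_fst.ae (coeFn_swapSurface x)
  have h3 : ∀ᵐ p : (I × I) × (I × I), swapSurface y p.2 = y p.2.swap :=
    Measure.quasiMeasurePreserving_snd.ae (coeFn_swapSurface y)
  filter_upwards [coeFn_swapOp (outer x y), h1, h2, h3,
    coeFn_outer (swapSurface x) (swapSurface y)] with p h4 h5 h6 h7 h8
  rw [h4, h8, h6, h7, Function.comp_apply, h5, Prod.map_fst, Prod.map_snd]

lemma swapOp_opTensor (a b : CurveOp) : swapOp (opTensor a b) = opTensor b a := by
  apply Lp.ext
  have h1 := measurePreserving_swap_swap.quasiMeasurePreserving.ae (coeFn_opTensor a b)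
  filter_upwards [coeFn_swapOp (opTensor a b), h1, coeFn_opTensor b a] with p h2 h3 h4
  rw [h2, h4, Function.comp_apply, h3, mul_comm]
  rfl

lemma contractFst_eq_contractSnd_swapOp (c : CurveOp) (k : SurfaceOp) :
    contractFst c k = contractSnd c (swapOp k) :=
  ext_inner_right ℝ fun a => by
    rw [inner_contractFst, inner_contractSnd, ← swapOp_opTensor c a, LinearIsometry.inner_map_map]

lemma shiftedPartialTrace₂_eq (δ : ℝ) (k : SurfaceOp) :
    shiftedPartialTrace₂ δ k = shiftedPartialTrace₁ δ (swapOp k) := by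
  simp only [shiftedPartialTrace₂, shiftedPartialTrace₁, contractFst_eq_contractSnd_swapOp]

lemma IsBanded.swapOp {δ : ℝ} {b : SurfaceOp} (h : IsBanded δ b) :
    IsBanded δ (SepBand.swapOp b) := by
  have hswap := measurePreserving_swap_swap.quasiMeasurePreserving.ae h
  unfold IsBanded
  filter_upwards [hswap, coeFn_swapOp b] with p h1 h2 h3
  rw [h2]
  refine h1 ?_
  rw [max_comm]
  exact h3

end Swap

section Nuclear

variable {α β ι : Type*} [MeasureSpace α] [MeasureSpace β]

/-- The kernel `k` has a nuclear expansion `∑ᵢ xᵢ ⊗ yᵢ` with `∑ᵢ ‖xᵢ‖ ‖yᵢ‖ ≤ r`, so its nuclear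
norm is at most `r`. -/
def HasNuclearBound (k : L2 (α × β)) (r : ℝ≥0) : Prop :=
  ∃ (ι : Type) (x : ι → L2 α) (y : ι → L2 β), HasSum (fun i => outer (x i) (y i)) k ∧
    ∑' i, ‖x i‖ₑ * ‖y i‖ₑ ≤ r

lemma summable_norm_mul_norm {E F : Type*} [NormedAddCommGroup E] [NormedAddCommGroup F]
    {x : ι → E} {y : ι → F} (h : ∑' i, ‖x i‖ₑ * ‖y i‖ₑ ≠ ∞) :
    Summable fun i => ‖x i‖ * ‖y i‖ :=
  Summable.of_enorm <| by simpa only [enorm_mul, enorm_norm] using h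

lemma enorm_le_tsum_enorm {E : Type*} [NormedAddCommGroup E] {f : ι → E} {a : E}
    (h : HasSum f a) : ‖a‖ₑ ≤ ∑' i, ‖f i‖ₑ :=
  h.tsum_eq ▸ enorm_tsum_le_tsum_enorm

lemma IsTraceClass.exists_hasNuclearBound {k : L2 (α × α)} (h : IsTraceClass k) :
    ∃ r, HasNuclearBound k r := by
  obtain ⟨w, e, f, -, hs, he, hf, hk⟩ := h
  simp only [← outer_smul_left] at hk
  have hterm (j) : ‖w j • e j‖ₑ * ‖f j‖ₑ = ‖w j‖ₑ := by
    rw [enorm_smul, ← ofReal_norm (e j), ← ofReal_norm (f j), he.1, hf.1, ENNReal.ofReal_one,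
      mul_one, mul_one]
  have hw : Summable fun j => ‖w j‖₊ := NNReal.summable_coe.1 (by exact hs.norm)
  have hr : ∑' j, ‖w j‖ₑ = ↑(∑' j, ‖w j‖₊) := by simp only [enorm_eq_nnnorm, ENNReal.coe_tsum hw]
  exact ⟨_, ℕ, fun j => w j • e j, f, hk, (tsum_congr hterm).trans_le hr.le⟩

namespace HasNuclearBound

section Map

variable {k : L2 (α × β)} {r : ℝ≥0} {G : Type*} [NormedAddCommGroup G] [NormedSpace ℝ G]
  {T : ι → L2 (α × β) →L[ℝ] G}

lemma tsum_enorm_map_le (h : HasNuclearBound k r)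
    (hT : ∀ x y, ∑' j, ‖T j (outer x y)‖ₑ ≤ ‖x‖ₑ * ‖y‖ₑ) : ∑' j, ‖T j k‖ₑ ≤ r := by
  obtain ⟨ι, x, y, hk, hr⟩ := h
  calc ∑' j, ‖T j k‖ₑ ≤ ∑' j, ∑' i, ‖T j (outer (x i) (y i))‖ₑ := by
        gcongr with j
        exact enorm_le_tsum_enorm (hk.mapL (T j))
    _ = ∑' i, ∑' j, ‖T j (outer (x i) (y i))‖ₑ := ENNReal.tsum_comm
    _ ≤ ∑' i, ‖x i‖ₑ * ‖y i‖ₑ := by gcongr with i; exact hT _ _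
    _ ≤ r := hr

lemma summable_map [CompleteSpace G] (h : HasNuclearBound k r)
    (hT : ∀ x y, ∑' j, ‖T j (outer x y)‖ₑ ≤ ‖x‖ₑ * ‖y‖ₑ) : Summable fun j => T j k :=
  Summable.of_enorm ((h.tsum_enorm_map_le hT).trans_lt ENNReal.coe_lt_top).ne

end Map

lemma swapOp {k : SurfaceOp} {r : ℝ≥0} (h : HasNuclearBound k r) :
    HasNuclearBound (SepBand.swapOp k) r := by
  obtain ⟨ι, x, y, hk, hr⟩ := h
  refine ⟨ι, fun i => swapSurface (x i), fun i => swapSurface (y i), ?_, ?_⟩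
  · simp only [← swapOp_outer]
    exact hk.mapL SepBand.swapOp.toContinuousLinearMap
  · simpa only [LinearIsometry.enorm_map] using hr

lemma contractFst_outer {k : SurfaceOp} {r : ℝ≥0} (h : HasNuclearBound k r) (u v : Curve) :
    HasNuclearBound (contractFst (outer u v) k) (‖u‖₊ * ‖v‖₊ * r) := by
  obtain ⟨ι, x, y, hk, hr⟩ := h
  refine ⟨ι, fun i => sliceFst u (x i), fun i => sliceFst v (y i), ?_, ?_⟩
  · simp only [← contractFst_outer_outer]
    exact hk.mapL _
  · have hslice (w : Curve) (z : Surface) : ‖sliceFst w z‖ₑ ≤ ‖w‖ₑ * ‖z‖ₑ := by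
      rw [← enorm_norm w, ← enorm_norm z, ← enorm_mul, enorm_le_iff_norm_le]
      simpa only [norm_mul, norm_norm] using norm_sliceFst_le w z
    calc ∑' i, ‖sliceFst u (x i)‖ₑ * ‖sliceFst v (y i)‖ₑ
        ≤ ∑' i, ‖u‖ₑ * ‖v‖ₑ * (‖x i‖ₑ * ‖y i‖ₑ) := by
          refine ENNReal.tsum_le_tsum fun i => ?_
          exact (mul_le_mul' (hslice _ _) (hslice _ _)).trans_eq (mul_mul_mul_comm _ _ _ _)
      _ ≤ ‖u‖ₑ * ‖v‖ₑ * r := by rw [ENNReal.tsum_mul_left]; gcongr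
      _ = ↑(‖u‖₊ * ‖v‖₊ * r) := by simp only [ENNReal.coe_mul, enorm_eq_nnnorm]

lemma opTensor {a b : CurveOp} {r s : ℝ≥0} (ha : HasNuclearBound a r)
    (hb : HasNuclearBound b s) : HasNuclearBound (SepBand.opTensor a b) (r * s) := by
  obtain ⟨ι, x, y, ha, hr⟩ := ha
  obtain ⟨κ, u, v, hb, hs⟩ := hb
  have hterm (p : ι × κ) : ‖outer (x p.1) (u p.2)‖ₑ * ‖outer (y p.1) (v p.2)‖ₑ
      = (‖x p.1‖ₑ * ‖y p.1‖ₑ) * (‖u p.2‖ₑ * ‖v p.2‖ₑ) := by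
    rw [enorm_outer, enorm_outer, mul_mul_mul_comm]
  have hbound : ∑' p : ι × κ, ‖outer (x p.1) (u p.2)‖ₑ * ‖outer (y p.1) (v p.2)‖ₑ ≤ ↑(r * s) := by
    simp only [hterm, ENNReal.tsum_prod', ENNReal.tsum_mul_left, ENNReal.tsum_mul_right,
      ENNReal.coe_mul]
    gcongr
  have hsummable : Summable fun p : ι × κ =>
      SepBand.opTensor (outer (x p.1) (y p.1)) (outer (u p.2) (v p.2)) := by
    refine Summable.of_enorm ?_
    simp only [opTensor_outer_outer, enorm_outer (outer _ _)]
    exact (hbound.trans_lt ENNReal.coe_lt_top).ne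
  have hfiber := hsummable.hasSum.prod_fiberwise fun i => hb.mapL (opTensorL (outer (x i) (y i)))
  have hsum : _ = SepBand.opTensor a b := hfiber.unique (ha.mapL (opTensorL.flip b))
  refine ⟨ι × κ, fun p => outer (x p.1) (u p.2), fun p => outer (y p.1) (v p.2), ?_, hbound⟩
  simp only [← opTensor_outer_outer]
  rw [← hsum]
  exact hsummable.hasSum

end HasNuclearBound

end Nuclear

section ShiftedTrace

lemma isBessel_basis : IsBessel basis := isBessel_of_orthonormal basis.orthonormal

lemma isBessel_shift_basis (δ : ℝ) : IsBessel fun j => shift δ (basis j) := by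
  simpa only [shiftL_apply] using isBessel_map_hilbertBasis basis (norm_shiftL_le δ)

/-- The shifted trace of an operator on `L²[0,1]`: the trace of the operator with kernel
`a(s, s' + δ)`. -/
def curveTrace (δ : ℝ) (a : CurveOp) : ℝ := ∑' j, ⟪a, shiftedDiag δ j⟫_ℝ

lemma tsum_enorm_inner_shiftedDiag_outer_le (δ : ℝ) (x y : Curve) :
    ∑' j, ‖innerSL ℝ (shiftedDiag δ j) (outer x y)‖ₑ ≤ ‖x‖ₑ * ‖y‖ₑ := by
  simp only [innerSL_apply_apply, shiftedDiag, real_inner_comm x, real_inner_comm y,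
    inner_outer_outer, enorm_mul]
  exact isBessel_basis.tsum_enorm_inner_mul_inner_le (isBessel_shift_basis δ) x y

lemma tsum_enorm_contractSnd_shiftedDiag_outer_le (δ : ℝ) (x y : Surface) :
    ∑' j, ‖contractSnd (shiftedDiag δ j) (outer x y)‖ₑ ≤ ‖x‖ₑ * ‖y‖ₑ := by
  simp only [shiftedDiag, contractSnd_outer_outer, enorm_outer]
  exact tsum_mul_le_of_tsum_sq_le (isBessel_basis.tsum_enorm_sliceSnd_sq_le x)
    ((isBessel_shift_basis δ).tsum_enorm_sliceSnd_sq_le y)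

lemma tsum_enorm_inner_opTensor_shiftedDiag_outer_le (δ : ℝ) (x y : Surface) :
    ∑' p : basisIndex × basisIndex,
      ‖innerSL ℝ (opTensor (shiftedDiag δ p.1) (shiftedDiag δ p.2)) (outer x y)‖ₑ
        ≤ ‖x‖ₑ * ‖y‖ₑ := by
  simp only [innerSL_apply_apply, shiftedDiag, opTensor_outer_outer,
    real_inner_comm x, real_inner_comm y, inner_outer_outer, enorm_mul]
  exact (isBessel_basis.outer isBessel_basis).tsum_enorm_inner_mul_inner_le
    ((isBessel_shift_basis δ).outer (isBessel_shift_basis δ)) x y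

namespace HasNuclearBound

lemma summable_inner_shiftedDiag {a : CurveOp} {r : ℝ≥0} (h : HasNuclearBound a r) (δ : ℝ) :
    Summable fun j => ⟪a, shiftedDiag δ j⟫_ℝ := by
  simpa only [innerSL_apply_apply, real_inner_comm a]
    using h.summable_map (tsum_enorm_inner_shiftedDiag_outer_le δ)

variable {k l : SurfaceOp} {r s : ℝ≥0}

lemma summable_contractSnd_shiftedDiag (h : HasNuclearBound k r) (δ : ℝ) :
    Summable fun j => contractSnd (shiftedDiag δ j) k :=
  h.summable_map (tsum_enorm_contractSnd_shiftedDiag_outer_le δ)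

lemma summable_inner_opTensor_shiftedDiag (h : HasNuclearBound k r) (δ : ℝ) :
    Summable fun p : basisIndex × basisIndex =>
      ⟪k, SepBand.opTensor (shiftedDiag δ p.1) (shiftedDiag δ p.2)⟫_ℝ := by
  simpa only [innerSL_apply_apply, real_inner_comm k]
    using h.summable_map (tsum_enorm_inner_opTensor_shiftedDiag_outer_le δ)

lemma norm_shiftedPartialTrace₁_le (h : HasNuclearBound k r) (δ : ℝ) :
    ‖shiftedPartialTrace₁ δ k‖ ≤ r := by
  have hle : ‖shiftedPartialTrace₁ δ k‖ₑ ≤ r := enorm_tsum_le_tsum_enorm.trans <|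
    h.tsum_enorm_map_le (tsum_enorm_contractSnd_shiftedDiag_outer_le δ)
  exact_mod_cast hle

lemma norm_shiftedPartialTrace₂_le (h : HasNuclearBound k r) (δ : ℝ) :
    ‖shiftedPartialTrace₂ δ k‖ ≤ r := by
  rw [shiftedPartialTrace₂_eq]
  exact h.swapOp.norm_shiftedPartialTrace₁_le δ

lemma norm_shiftedTrace_le (h : HasNuclearBound k r) (δ : ℝ) : ‖shiftedTrace δ k‖ ≤ r := by
  have hle : ‖shiftedTrace δ k‖ₑ ≤ r := enorm_tsum_le_tsum_enorm.trans <| by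
    simpa only [innerSL_apply_apply, real_inner_comm k]
      using h.tsum_enorm_map_le (tsum_enorm_inner_opTensor_shiftedDiag_outer_le δ)
  exact_mod_cast hle

lemma shiftedPartialTrace₁_add (hk : HasNuclearBound k r) (hl : HasNuclearBound l s) (δ : ℝ) :
    shiftedPartialTrace₁ δ (k + l) = shiftedPartialTrace₁ δ k + shiftedPartialTrace₁ δ l := by
  simp only [shiftedPartialTrace₁, map_add]
  exact (hk.summable_contractSnd_shiftedDiag δ).tsum_add (hl.summable_contractSnd_shiftedDiag δ)

lemma shiftedPartialTrace₂_add (hk : HasNuclearBound k r) (hl : HasNuclearBound l s) (δ : ℝ) :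
    shiftedPartialTrace₂ δ (k + l) = shiftedPartialTrace₂ δ k + shiftedPartialTrace₂ δ l := by
  simp only [shiftedPartialTrace₂_eq, map_add]
  exact hk.swapOp.shiftedPartialTrace₁_add hl.swapOp δ

lemma shiftedTrace_add (hk : HasNuclearBound k r) (hl : HasNuclearBound l s) (δ : ℝ) :
    shiftedTrace δ (k + l) = shiftedTrace δ k + shiftedTrace δ l := by
  simp only [shiftedTrace, inner_add_left]
  exact (hk.summable_inner_opTensor_shiftedDiag δ).tsum_add
    (hl.summable_inner_opTensor_shiftedDiag δ)

lemma inner_shiftedPartialTrace₁ (h : HasNuclearBound k r) (δ : ℝ) (a : CurveOp) :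
    ⟪shiftedPartialTrace₁ δ k, a⟫_ℝ = curveTrace δ (contractFst a k) := by
  rw [real_inner_comm, shiftedPartialTrace₁, ← innerSL_apply_apply ℝ,
    (innerSL ℝ a).map_tsum (h.summable_contractSnd_shiftedDiag δ), curveTrace]
  simp only [innerSL_apply_apply, real_inner_comm _ a, inner_contractSnd, inner_contractFst]

lemma shiftedTrace_eq_curveTrace (h : HasNuclearBound k r) (δ : ℝ) :
    shiftedTrace δ k = curveTrace δ (shiftedPartialTrace₁ δ k) := by
  rw [shiftedTrace, (h.summable_inner_opTensor_shiftedDiag δ).tsum_prod, curveTrace]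
  simp only [h.inner_shiftedPartialTrace₁, curveTrace, inner_contractFst]

end HasNuclearBound

lemma curveTrace_zero (δ : ℝ) : curveTrace δ 0 = 0 := by
  simp only [curveTrace, inner_zero_left, tsum_zero]

lemma curveTrace_smul (δ c : ℝ) (a : CurveOp) : curveTrace δ (c • a) = c * curveTrace δ a := by
  simp only [curveTrace, real_inner_smul_left, tsum_mul_left]

lemma shiftedPartialTrace₁_opTensor (a : CurveOp) {b : CurveOp} {s : ℝ≥0}
    (hb : HasNuclearBound b s) (δ : ℝ) :
    shiftedPartialTrace₁ δ (opTensor a b) = curveTrace δ b • a := by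
  simp only [shiftedPartialTrace₁, contractSnd_opTensor, curveTrace]
  exact (hb.summable_inner_shiftedDiag δ).tsum_smul_const a

lemma shiftedPartialTrace₂_opTensor {a : CurveOp} (b : CurveOp) {r : ℝ≥0}
    (ha : HasNuclearBound a r) (δ : ℝ) :
    shiftedPartialTrace₂ δ (opTensor a b) = curveTrace δ a • b := by
  rw [shiftedPartialTrace₂_eq, swapOp_opTensor, shiftedPartialTrace₁_opTensor b ha]

lemma shiftedTrace_opTensor {a b : CurveOp} {r s : ℝ≥0} (ha : HasNuclearBound a r)
    (hb : HasNuclearBound b s) (δ : ℝ) :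
    shiftedTrace δ (opTensor a b) = curveTrace δ a * curveTrace δ b := by
  rw [(ha.opTensor hb).shiftedTrace_eq_curveTrace, shiftedPartialTrace₁_opTensor a hb,
    curveTrace_smul, mul_comm]

end ShiftedTrace

section Banded

/-- The operator on `L²[0,1]` with kernel `a` is banded by `δ`. -/
def IsCurveBanded (δ : ℝ) (a : CurveOp) : Prop :=
  ∀ᵐ p : I × I, δ ≤ |(p.1 : ℝ) - p.2| → a p = 0

lemma IsBanded.contractFst {δ : ℝ} {k : SurfaceOp} (hk : IsBanded δ k) (c : CurveOp) :
    IsCurveBanded δ (contractFst c k) := by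
  set S : Set (I × I) := {p | δ ≤ |(p.1 : ℝ) - p.2|}
  have hS : MeasurableSet S := measurableSet_le measurable_const (by fun_prop)
  have hcut : cut S (SepBand.contractFst c k) = 0 := by
    refine ext_inner_right ℝ fun g => ?_
    rw [inner_cut_left, inner_contractFst, inner_zero_left, L2.inner_def, ← integral_zero]
    refine integral_congr_ae ?_
    have hg : ∀ᵐ p : (I × I) × (I × I), cut S g (p.1.2, p.2.2) = S.indicator g (p.1.2, p.2.2) :=
      (Measure.quasiMeasurePreserving_snd.comp
        measurePreserving_regroup.quasiMeasurePreserving).ae (coeFn_cut hS g)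
    filter_upwards [hk, coeFn_opTensor c (cut S g), hg] with p h1 h2 h3
    rw [h2, h3, Set.indicator_apply]
    split_ifs with hp
    · rw [h1 (le_max_of_le_right hp), inner_zero_left]
    · rw [mul_zero, inner_zero_right]
  unfold IsCurveBanded
  filter_upwards [coeFn_cut hS (SepBand.contractFst c k), Lp.eq_zero_iff_ae_eq_zero.1 hcut]
    with p h1 h2 hp
  rw [← Set.indicator_of_mem (s := S) hp (SepBand.contractFst c k), ← h1, h2, Pi.zero_apply]

lemma enorm_apply_le_of_norm_le_one {E F : Type*} [NormedAddCommGroup E] [NormedSpace ℝ E]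
    [NormedAddCommGroup F] [NormedSpace ℝ F] {T : E →L[ℝ] F} (hT : ‖T‖ ≤ 1) (x : E) :
    ‖T x‖ₑ ≤ ‖x‖ₑ := by
  rw [enorm_le_iff_norm_le]
  exact (T.le_of_opNorm_le hT x).trans_eq (one_mul _)

variable {ι : Type*} {x y : ι → Curve} {a : CurveOp}

lemma curveTrace_eq_tsum_inner_shiftL (ha : HasSum (fun i => outer (x i) (y i)) a)
    (h : ∑' i, ‖x i‖ₑ * ‖y i‖ₑ ≠ ∞) (δ : ℝ) :
    curveTrace δ a = ∑' i, ⟪shiftL δ (x i), y i⟫_ℝ := by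
  have hsummable : Summable fun p : ι × basisIndex =>
      ⟪shiftedDiag δ p.2, outer (x p.1) (y p.1)⟫_ℝ := by
    refine Summable.of_enorm (ne_top_of_le_ne_top h ?_)
    rw [ENNReal.tsum_prod']
    exact ENNReal.tsum_le_tsum fun i => tsum_enorm_inner_shiftedDiag_outer_le δ (x i) (y i)
  have hsum_i (j) : ∑' i, ⟪shiftedDiag δ j, outer (x i) (y i)⟫_ℝ = ⟪a, shiftedDiag δ j⟫_ℝ := by
    rw [real_inner_comm]
    exact (ha.mapL (innerSL ℝ (shiftedDiag δ j))).tsum_eq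
  have hsum_j (i) : ∑' j, ⟪shiftedDiag δ j, outer (x i) (y i)⟫_ℝ = ⟪shiftL δ (x i), y i⟫_ℝ := by
    rw [← ContinuousLinearMap.adjoint_inner_right,
      ← (basis.hasSum_inner_mul_inner (x i) _).tsum_eq]
    simp only [shiftedDiag, inner_outer_outer, ContinuousLinearMap.adjoint_inner_right,
      shiftL_apply, real_inner_comm (x i)]
  calc curveTrace δ a = ∑' j, ∑' i, ⟪shiftedDiag δ j, outer (x i) (y i)⟫_ℝ := by
        simp only [hsum_i, curveTrace]
    _ = ∑' i, ∑' j, ⟪shiftedDiag δ j, outer (x i) (y i)⟫_ℝ := hsummable.tsum_comm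
    _ = ∑' i, ⟪shiftL δ (x i), y i⟫_ℝ := tsum_congr hsum_j

lemma tsum_enorm_cut_mul_enorm_cut_ne_top (h : ∑' i, ‖x i‖ₑ * ‖y i‖ₑ ≠ ∞) (S T : Set I) :
    ∑' i, ‖cut S (x i)‖ₑ * ‖cut T (y i)‖ₑ ≠ ∞ :=
  ne_top_of_le_ne_top h <| ENNReal.tsum_le_tsum fun i => mul_le_mul'
    (enorm_apply_le_of_norm_le_one (norm_cut_le S) (x i))
    (enorm_apply_le_of_norm_le_one (norm_cut_le T) (y i))

variable {δstar δ : ℝ}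

lemma tsum_inner_shiftL_cut_eq_zero (ha : HasSum (fun i => outer (x i) (y i)) a)
    (h : ∑' i, ‖x i‖ₑ * ‖y i‖ₑ ≠ ∞) (hband : IsCurveBanded δstar a) {J : Set I}
    (hJ : MeasurableSet J) (hdist : ∀ t ∈ J, ∀ t' ∈ J, δstar ≤ |(t : ℝ) - (t' + δ)|) :
    ∑' i, ⟪shiftL δ (cut J (x i)), y i⟫_ℝ = 0 := by
  set T : Set I := {s : I | (s : ℝ) - δ ∈ ((↑) : I → ℝ) '' J} with hTdef
  have hT : MeasurableSet T := measurableSet_translate δ hJ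
  have hzero : cut (J ×ˢ T) a = 0 := cut_eq_zero (hJ.prod hT) <| by
    filter_upwards [hband] with p hp hmem
    obtain ⟨hpJ, t', ht', hpt'⟩ := hmem
    refine hp ?_
    rw [sub_eq_iff_eq_add.1 hpt'.symm]
    exact hdist _ hpJ _ ht'
  have hsum : HasSum (fun i => outer (cut J (x i)) (cut T (y i))) (cut (J ×ˢ T) a) := by
    simp only [outer_cut_cut hJ hT]
    exact ha.mapL _
  calc ∑' i, ⟪shiftL δ (cut J (x i)), y i⟫_ℝ
      = ∑' i, ⟪shiftL δ (cut J (x i)), cut T (y i)⟫_ℝ := by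
        simp only [← inner_cut_left, hTdef, shiftL_cut δ hJ]
    _ = curveTrace δ (cut (J ×ˢ T) a) := (curveTrace_eq_tsum_inner_shiftL hsum
        (tsum_enorm_cut_mul_enorm_cut_ne_top h J T) δ).symm
    _ = 0 := by rw [hzero, curveTrace_zero]

-- On a set of diameter less than `δ - δstar`, the shift by `δ` moves every point farther than
-- `δstar` from the set, so the kernel restricted to the set and its translate vanishes.
lemma tsum_inner_shiftL_eq_zero_of_lt (ha : HasSum (fun i => outer (x i) (y i)) a)
    (h : ∑' i, ‖x i‖ₑ * ‖y i‖ₑ ≠ ∞) (hband : IsCurveBanded δstar a) (hδ : δstar < δ) :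
    ∑' i, ⟪shiftL δ (x i), y i⟫_ℝ = 0 := by
  have hη : 0 < δ - δstar := sub_pos.2 hδ
  set φ : I → ℤ := fun s => ⌊(s : ℝ) / (δ - δstar)⌋
  have hφm : Measurable φ := Int.measurable_floor.comp (by fun_prop)
  have hφs (s) : φ s ∈ Finset.Icc 0 ⌊1 / (δ - δstar)⌋ := by
    rw [Finset.mem_Icc, Int.floor_nonneg]
    exact ⟨div_nonneg s.2.1 hη.le, Int.floor_le_floor (by gcongr; exact s.2.2)⟩
  have hpiece (m) : ∑' i, ⟪shiftL δ (cut (φ ⁻¹' {m}) (x i)), y i⟫_ℝ = 0 := by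
    refine tsum_inner_shiftL_cut_eq_zero ha h hband (hφm (measurableSet_singleton m)) ?_
    rintro t ht t' ht'
    have hclose := Int.abs_sub_lt_one_of_floor_eq_floor (Eq.trans ht ht'.symm)
    rw [← sub_div, abs_div, abs_of_pos hη, div_lt_one hη] at hclose
    rw [abs_sub_comm]
    refine le_trans ?_ (le_abs_self _)
    linarith [le_abs_self ((t : ℝ) - t')]
  have hsummable (m) : Summable fun i => ⟪shiftL δ (cut (φ ⁻¹' {m}) (x i)), y i⟫_ℝ := by
    refine Summable.of_norm_bounded (summable_norm_mul_norm h) fun i => ?_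
    refine (norm_inner_le_norm _ _).trans ?_
    gcongr
    simpa only [one_mul] using ((shiftL δ).le_of_opNorm_le (norm_shiftL_le δ) _).trans
      (mul_le_mul_of_nonneg_left ((cut _).le_of_opNorm_le (norm_cut_le _) (x i)) zero_le_one)
  calc ∑' i, ⟪shiftL δ (x i), y i⟫_ℝ
      = ∑' i, ∑ m ∈ Finset.Icc 0 ⌊1 / (δ - δstar)⌋,
          ⟪shiftL δ (cut (φ ⁻¹' {m}) (x i)), y i⟫_ℝ := by
        simp only [← sum_inner, ← map_sum, sum_cut_preimage hφm hφs]
    _ = ∑ m ∈ Finset.Icc 0 ⌊1 / (δ - δstar)⌋,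
          ∑' i, ⟪shiftL δ (cut (φ ⁻¹' {m}) (x i)), y i⟫_ℝ :=
        Summable.tsum_finsetSum fun m _ => hsummable m
    _ = 0 := Finset.sum_eq_zero fun m _ => hpiece m

lemma continuous_tsum_inner_shiftL (h : ∑' i, ‖x i‖ₑ * ‖y i‖ₑ ≠ ∞) :
    Continuous fun δ => ∑' i, ⟪shiftL δ (x i), y i⟫_ℝ := by
  refine continuous_tsum (fun i => (continuous_shiftL_apply _).inner continuous_const)
    (summable_norm_mul_norm h) fun i δ => (norm_inner_le_norm _ _).trans ?_
  gcongr
  exact ((shiftL δ).le_of_opNorm_le (norm_shiftL_le δ) _).trans_eq (one_mul _)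

lemma IsCurveBanded.curveTrace_eq_zero {r : ℝ≥0} (hband : IsCurveBanded δstar a)
    (ha : HasNuclearBound a r) (hδ : δstar ≤ δ) : curveTrace δ a = 0 := by
  obtain ⟨ι, x, y, ha, hr⟩ := ha
  have h : ∑' i, ‖x i‖ₑ * ‖y i‖ₑ ≠ ∞ := (hr.trans_lt ENNReal.coe_lt_top).ne
  have hIoi : Set.EqOn (fun δ => ∑' i, ⟪shiftL δ (x i), y i⟫_ℝ) 0 (Set.Ioi δstar) :=
    fun δ hδ => tsum_inner_shiftL_eq_zero_of_lt ha h hband hδ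
  have hIci := hIoi.closure (continuous_tsum_inner_shiftL h) continuous_zero
  rw [closure_Ioi] at hIci
  rw [curveTrace_eq_tsum_inner_shiftL ha h]
  exact hIci hδ

namespace IsBanded

variable {k : SurfaceOp} {r : ℝ≥0}

lemma shiftedPartialTrace₁_eq_zero (hk : IsBanded δstar k) (h : HasNuclearBound k r)
    (hδ : δstar ≤ δ) : shiftedPartialTrace₁ δ k = 0 :=
  eq_zero_of_forall_inner_outer_eq_zero fun u v => by
    rw [h.inner_shiftedPartialTrace₁]
    exact (hk.contractFst _).curveTrace_eq_zero (h.contractFst_outer u v) hδ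

lemma shiftedPartialTrace₂_eq_zero (hk : IsBanded δstar k) (h : HasNuclearBound k r)
    (hδ : δstar ≤ δ) : shiftedPartialTrace₂ δ k = 0 := by
  rw [shiftedPartialTrace₂_eq]
  exact hk.swapOp.shiftedPartialTrace₁_eq_zero h.swapOp hδ

lemma shiftedTrace_eq_zero (hk : IsBanded δstar k) (h : HasNuclearBound k r) (hδ : δstar ≤ δ) :
    shiftedTrace δ k = 0 := by
  rw [h.shiftedTrace_eq_curveTrace, hk.shiftedPartialTrace₁_eq_zero h hδ, curveTrace_zero]

end IsBanded

end Banded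

section Model

variable {a₁ a₂ : CurveOp} {b : SurfaceOp} {δstar δ : ℝ}

lemma separablePart_opTensor_add (h₁ : IsTraceClass a₁) (h₂ : IsTraceClass a₂)
    (hb : IsTraceClass b) (hband : IsBanded δstar b) (hδ : δstar ≤ δ)
    (htrace : shiftedTrace δ (opTensor a₁ a₂ + b) ≠ 0) :
    separablePart δ (opTensor a₁ a₂ + b) = opTensor a₁ a₂ := by
  obtain ⟨r₁, h₁⟩ := h₁.exists_hasNuclearBound
  obtain ⟨r₂, h₂⟩ := h₂.exists_hasNuclearBound
  obtain ⟨r, hb⟩ := hb.exists_hasNuclearBound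
  have h₁₂ := h₁.opTensor h₂
  have htr : shiftedTrace δ (opTensor a₁ a₂ + b) = curveTrace δ a₁ * curveTrace δ a₂ := by
    rw [h₁₂.shiftedTrace_add hb, hband.shiftedTrace_eq_zero hb hδ, add_zero,
      shiftedTrace_opTensor h₁ h₂]
  rw [htr] at htrace
  rw [separablePart, htr, h₁₂.shiftedPartialTrace₁_add hb, h₁₂.shiftedPartialTrace₂_add hb,
    hband.shiftedPartialTrace₁_eq_zero hb hδ, hband.shiftedPartialTrace₂_eq_zero hb hδ,
    add_zero, add_zero, shiftedPartialTrace₁_opTensor a₁ h₂, shiftedPartialTrace₂_opTensor a₂ h₁]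
  simp only [← opTensorL_apply, map_smul, smul_apply, smul_smul]
  rw [inv_mul_eq_div, div_mul_eq_mul_div, div_self htrace, one_smul]

lemma bandedPart_opTensor_add (hb : b ∈ stationary)
    (hsep : separablePart δ (opTensor a₁ a₂ + b) = opTensor a₁ a₂) :
    bandedPart δ (opTensor a₁ a₂ + b) = b := by
  rw [bandedPart, hsep, add_sub_cancel_left]
  exact Submodule.starProjection_eq_self_iff.2 (stationary.le_topologicalClosure hb)

lemma theoreticalCriterion_opTensor_add (hb : b ∈ stationary)
    (hsep : separablePart δ (opTensor a₁ a₂ + b) = opTensor a₁ a₂) :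
    theoreticalCriterion (opTensor a₁ a₂ + b) δ = 0 := by
  rw [theoreticalCriterion, proxy, bandedPart_opTensor_add hb hsep, hsep, sub_self, norm_zero,
    zero_pow two_ne_zero]

end Model

section L1Norm

variable {ι H : Type*} [NormedAddCommGroup H] [InnerProductSpace ℝ H]

/-- The sum of the absolute values of the coefficients of `x` in the orthonormal basis `b`,
possibly infinite. In a basis of products `eᵢ ⊗ eⱼ` it dominates the nuclear norm of a kernel, and
unlike the nuclear norm its moments can be computed coefficient by coefficient. -/
def l1Norm (b : HilbertBasis ι ℝ H) (x : H) : ℝ≥0∞ := ∑' j, ‖⟪x, b j⟫_ℝ‖ₑ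

variable (b : HilbertBasis ι ℝ H)

lemma l1Norm_add_le (x y : H) : l1Norm b (x + y) ≤ l1Norm b x + l1Norm b y := by
  simp only [l1Norm, ← ENNReal.tsum_add, inner_add_left]
  gcongr
  exact enorm_add_le _ _

lemma l1Norm_smul (r : ℝ) (x : H) : l1Norm b (r • x) = ‖r‖ₑ * l1Norm b x := by
  simp only [l1Norm, ← ENNReal.tsum_mul_left, real_inner_smul_left, enorm_mul]

lemma l1Norm_sub_le (x y : H) : l1Norm b (x - y) ≤ l1Norm b x + l1Norm b y := by
  simp only [l1Norm, ← ENNReal.tsum_add, inner_sub_left]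
  gcongr
  exact enorm_sub_le

lemma enorm_hilbertBasis (j : ι) : ‖b j‖ₑ = 1 := by
  rw [← ofReal_norm, b.orthonormal.1, ENNReal.ofReal_one]

lemma enorm_le_l1Norm (x : H) : ‖x‖ₑ ≤ l1Norm b x := by
  refine (enorm_le_tsum_enorm (b.hasSum_repr x)).trans_eq (tsum_congr fun j => ?_)
  rw [enorm_smul, enorm_hilbertBasis, mul_one, HilbertBasis.repr_apply_apply, real_inner_comm]

lemma norm_le_of_l1Norm_le {x : H} {r : ℝ≥0} (h : l1Norm b x ≤ r) : ‖x‖ ≤ r := by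
  have := (enorm_le_l1Norm b x).trans h
  rwa [enorm_eq_nnnorm, ENNReal.coe_le_coe] at this

end L1Norm

section L1NormOuter

variable {α β : Type*} [MeasureSpace α] [MeasureSpace β]
  [IsFiniteMeasure (volume : Measure α)] [IsFiniteMeasure (volume : Measure β)]

lemma l1Norm_outerBasis_outer {ι κ : Type*} (b : HilbertBasis ι ℝ (L2 α))
    (c : HilbertBasis κ ℝ (L2 β)) (x : L2 α) (y : L2 β) :
    l1Norm (outerBasis b c) (outer x y) = l1Norm b x * l1Norm c y := by
  simp only [l1Norm, ENNReal.tsum_prod', outerBasis_apply, inner_outer_outer, enorm_mul,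
    ENNReal.tsum_mul_left, ENNReal.tsum_mul_right]

lemma hasNuclearBound_of_l1Norm_le {ι κ : Type} (b : HilbertBasis ι ℝ (L2 α))
    (c : HilbertBasis κ ℝ (L2 β)) {k : L2 (α × β)} {r : ℝ≥0}
    (h : l1Norm (outerBasis b c) k ≤ r) : HasNuclearBound k r := by
  refine ⟨ι × κ, fun p => ⟪k, outer (b p.1) (c p.2)⟫_ℝ • b p.1, fun p => c p.2, ?_, ?_⟩
  · simpa only [HilbertBasis.repr_apply_apply, outerBasis_apply, ← outer_smul_left,
      real_inner_comm k] using (outerBasis b c).hasSum_repr k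
  · simpa only [l1Norm, outerBasis_apply, enorm_smul, enorm_hilbertBasis, mul_one] using h

lemma sum_enorm_sq_le_l1Norm {ι ν : Type*} (b : HilbertBasis ι ℝ (L2 α)) (x : ν → L2 α)
    (S : Finset ν) :
    ∑ n ∈ S, ‖x n‖ₑ ^ 2 ≤ l1Norm (outerBasis b b) (∑ n ∈ S, outer (x n) (x n)) := by
  have hdiag (j) : ∑ n ∈ S, ‖⟪x n, b j⟫_ℝ‖ₑ ^ 2
      = ‖⟪∑ n ∈ S, outer (x n) (x n), outer (b j) (b j)⟫_ℝ‖ₑ := by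
    simp only [sum_inner, inner_outer_outer, ← pow_two, ← enorm_pow]
    simp only [Real.enorm_of_nonneg (sq_nonneg _),
      Real.enorm_of_nonneg (Finset.sum_nonneg fun _ _ => sq_nonneg _),
      ENNReal.ofReal_sum_of_nonneg fun _ _ => sq_nonneg _]
  simp only [← tsum_enorm_inner_sq b]
  rw [← Summable.tsum_finsetSum fun _ _ => ENNReal.summable, l1Norm, ENNReal.tsum_prod']
  simp only [hdiag, outerBasis_apply]
  gcongr with j
  exact ENNReal.le_tsum (f := fun l =>
    ‖⟪∑ n ∈ S, outer (x n) (x n), outer (b j) (b l)⟫_ℝ‖ₑ) j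

end L1NormOuter

section Lipschitz

variable {c : SurfaceOp} {s : ℝ≥0}

lemma exists_norm_opTensor_inv_smul_sub_le (a b : CurveOp) {t : ℝ} (ht : t ≠ 0) :
    ∃ L : ℝ≥0, ∀ᶠ r : ℝ≥0 in 𝓝 0, ∀ (a' b' : CurveOp) (t' : ℝ),
      ‖a' - a‖ ≤ r → ‖t' - t‖ ≤ r → ‖b' - b‖ ≤ r →
        ‖opTensor a' (t'⁻¹ • b') - opTensor a (t⁻¹ • b)‖ ≤ L * r := by
  have hdiff : DifferentiableAt ℝ
      (fun p : CurveOp × ℝ × CurveOp => opTensorL p.1 (p.2.1⁻¹ • p.2.2)) (a, t, b) := by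
    have hinv : DifferentiableAt ℝ (fun p : CurveOp × ℝ × CurveOp => p.2.1⁻¹) (a, t, b) :=
      differentiableAt_snd.fst.fun_inv ht
    have hleft : DifferentiableAt ℝ (fun p : CurveOp × ℝ × CurveOp => opTensorL p.1) (a, t, b) := by
      fun_prop
    exact hleft.clm_apply (hinv.smul (by fun_prop))
  obtain ⟨L, hL, hbound⟩ := hdiff.isBigO_sub.exists_pos
  obtain ⟨ρ, hρ, hball⟩ := Metric.eventually_nhds_iff.1 hbound.bound
  refine ⟨⟨L, hL.le⟩, ?_⟩
  filter_upwards [eventually_lt_nhds (Real.toNNReal_pos.2 hρ)] with r hr a' b' t' ha ht' hb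
  have hnorm : ‖((a', t', b') : CurveOp × ℝ × CurveOp) - (a, t, b)‖ ≤ r := by
    simp only [Prod.mk_sub_mk, Prod.norm_mk, sup_le_iff]
    exact ⟨ha, ht', hb⟩
  refine (hball (y := (a', t', b')) ?_).trans (mul_le_mul_of_nonneg_left hnorm hL.le)
  rw [dist_eq_norm]
  exact hnorm.trans_lt (Real.lt_toNNReal_iff_coe_lt.1 hr)

lemma exists_norm_separablePart_sub_le (hc : HasNuclearBound c s) {δ : ℝ}
    (ht : shiftedTrace δ c ≠ 0) :
    ∃ L : ℝ≥0, ∀ᶠ r : ℝ≥0 in 𝓝 0, ∀ k, HasNuclearBound (k - c) r →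
      ‖separablePart δ k - separablePart δ c‖ ≤ L * r := by
  obtain ⟨L, hL⟩ := exists_norm_opTensor_inv_smul_sub_le (shiftedPartialTrace₁ δ c)
    (shiftedPartialTrace₂ δ c) ht
  refine ⟨L, hL.mono fun r h k hk => h _ _ _ ?_ ?_ ?_⟩
  · have := hc.shiftedPartialTrace₁_add hk δ
    rw [add_sub_cancel] at this
    rw [this, add_sub_cancel_left]
    exact hk.norm_shiftedPartialTrace₁_le δ
  · have := hc.shiftedTrace_add hk δ
    rw [add_sub_cancel] at this
    rw [this, add_sub_cancel_left]
    exact hk.norm_shiftedTrace_le δ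
  · have := hc.shiftedPartialTrace₂_add hk δ
    rw [add_sub_cancel] at this
    rw [this, add_sub_cancel_left]
    exact hk.norm_shiftedPartialTrace₂_le δ

lemma exists_norm_separablePart_sub_le_finset (hc : HasNuclearBound c s) {Δ : Finset ℝ}
    (ht : ∀ δ ∈ Δ, shiftedTrace δ c ≠ 0) :
    ∃ L : ℝ≥0, ∀ᶠ r : ℝ≥0 in 𝓝 0, ∀ k, HasNuclearBound (k - c) r →
      ∀ δ ∈ Δ, ‖separablePart δ k - separablePart δ c‖ ≤ L * r := by
  choose! L hL using fun δ (hδ : δ ∈ Δ) => exists_norm_separablePart_sub_le hc (ht δ hδ)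
  refine ⟨∑ δ ∈ Δ, L δ, ?_⟩
  filter_upwards [(eventually_all_finset Δ).2 hL] with r h k hk δ hδ
  have hle : L δ ≤ ∑ δ ∈ Δ, L δ := Finset.single_le_sum (fun _ _ => zero_le) hδ
  exact (h δ hδ k hk).trans (mul_le_mul_of_nonneg_right hle r.2)

lemma norm_toeplitzAvg_le (k : SurfaceOp) : ‖toeplitzAvg k‖ ≤ ‖k‖ :=
  (toeplitzAvg.le_of_opNorm_le (Submodule.starProjection_norm_le _) k).trans (one_mul _).le

lemma norm_bandedPart_sub_le (δ : ℝ) (k c : SurfaceOp) :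
    ‖bandedPart δ k - bandedPart δ c‖ ≤ ‖k - c‖ + ‖separablePart δ k - separablePart δ c‖ := by
  rw [bandedPart, bandedPart, ← map_sub, sub_sub_sub_comm]
  exact (norm_toeplitzAvg_le _).trans (norm_sub_le _ _)

lemma norm_proxy_sub_le (δ : ℝ) (k c : SurfaceOp) :
    ‖proxy δ k - proxy δ c‖ ≤ ‖k - c‖ + 2 * ‖separablePart δ k - separablePart δ c‖ := by
  rw [proxy, proxy, add_sub_add_comm]
  linarith [norm_add_le (separablePart δ k - separablePart δ c)
    (bandedPart δ k - bandedPart δ c), norm_bandedPart_sub_le δ k c]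

end Lipschitz

section EmpCov

variable {e : HilbertBasis ℕ ℝ Surface} {c : SurfaceOp} {x : ℕ → Surface} {N : ℕ} {η : ℝ≥0}

/-- The raw second moment `|S|⁻¹ ∑ xₙ ⊗ xₙ` of the surfaces `xₙ`, `n ∈ S`. -/
def secondMoment (x : ℕ → Surface) (S : Finset ℕ) : SurfaceOp :=
  (S.card : ℝ)⁻¹ • ∑ n ∈ S, outer (x n) (x n)

lemma empCov_eq (x : ℕ → Surface) (S : Finset ℕ) :
    empCov x S = secondMoment x S - outer (sampleMean x S) (sampleMean x S) := by
  rcases S.eq_empty_or_nonempty with rfl | hS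
  · have : outer (0 : Surface) (0 : Surface) = 0 := by rw [← outerL_apply, map_zero]
    simp [empCov, secondMoment, sampleMean, this]
  have hcard : (S.card : ℝ) ≠ 0 := by exact_mod_cast hS.card_pos.ne'
  have hsum : ∑ n ∈ S, x n = (S.card : ℝ) • sampleMean x S := by
    rw [sampleMean, smul_inv_smul₀ hcard]
  simp only [empCov, secondMoment, ← outerL_apply, map_sub, sub_apply, Finset.sum_sub_distrib]
  simp only [← map_sum, ← sum_apply, hsum, map_smul, smul_apply, Finset.sum_const, smul_sub,
    inv_smul_smul₀ hcard, ← Nat.cast_smul_eq_nsmul ℝ]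
  abel

lemma l1Norm_empCov_sub_le (e : HilbertBasis ℕ ℝ Surface) (c : SurfaceOp) (x : ℕ → Surface)
    (S : Finset ℕ) :
    l1Norm (outerBasis e e) (empCov x S - c) ≤
      l1Norm (outerBasis e e) (secondMoment x S - c) + l1Norm e (sampleMean x S) ^ 2 := by
  rw [empCov_eq, sub_right_comm, pow_two, ← l1Norm_outerBasis_outer]
  exact l1Norm_sub_le _ _ _

lemma sampleMean_erase (x : ℕ → Surface) (hN : N ≠ 0) {n : ℕ} (hn : n < N) :
    sampleMean x ((Finset.range N).erase n) =
      ((N : ℝ) - 1)⁻¹ • ((N : ℝ) • sampleMean x (Finset.range N) - x n) := by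
  rw [sampleMean, sampleMean, Finset.card_erase_of_mem (Finset.mem_range.2 hn), Finset.card_range,
    Nat.cast_pred (Nat.pos_of_ne_zero hN), smul_inv_smul₀ (Nat.cast_ne_zero.2 hN),
    Finset.sum_erase_eq_sub (Finset.mem_range.2 hn)]

lemma secondMoment_erase_sub (x : ℕ → Surface) (c : SurfaceOp) (hN : 2 ≤ N) {n : ℕ} (hn : n < N) :
    secondMoment x ((Finset.range N).erase n) - c =
      ((N : ℝ) - 1)⁻¹ • ((N : ℝ) • (secondMoment x (Finset.range N) - c) + c
        - outer (x n) (x n)) := by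
  have hN0 : (N : ℝ) ≠ 0 := by positivity
  have hN1 : (N : ℝ) - 1 ≠ 0 := sub_ne_zero.2 (by exact_mod_cast (by omega : N ≠ 1))
  rw [secondMoment, secondMoment, Finset.card_erase_of_mem (Finset.mem_range.2 hn),
    Finset.card_range, Nat.cast_pred (by omega), Finset.sum_erase_eq_sub (Finset.mem_range.2 hn),
    eq_inv_smul_iff₀ hN1, smul_sub, smul_inv_smul₀ hN1, smul_sub, smul_inv_smul₀ hN0, sub_smul,
    one_smul]
  abel

/-- The sample `x₀, …, x_{N-1}` behaves, up to `η`, like one from a centred law with covariance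
`c`: its first two moments are `η`-close to those of the law, and neither a single observation
nor `c` itself contributes more than order `η` to an average over the sample. -/
structure IsTypicalSample (e : HilbertBasis ℕ ℝ Surface) (c : SurfaceOp) (x : ℕ → Surface) (N : ℕ)
    (η : ℝ≥0) : Prop where
  two_le : 2 ≤ N
  le_one : η ≤ 1
  covariance_le : l1Norm (outerBasis e e) c ≤ η * N
  secondMoment_sub_le : l1Norm (outerBasis e e) (secondMoment x (Finset.range N) - c) ≤ η
  sampleMean_le : l1Norm e (sampleMean x (Finset.range N)) ≤ η
  sq_le : ∀ n < N, l1Norm e (x n) ^ 2 ≤ η ^ 2 * N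

lemma enorm_inv_natCast_sub_one_mul_le (hN : 2 ≤ N) : ‖((N : ℝ) - 1)⁻¹‖ₑ * (N : ℝ≥0∞) ≤ 2 := by
  have hN' : (2 : ℝ) ≤ N := by exact_mod_cast hN
  have h : ((N : ℝ) - 1)⁻¹ * N ≤ 2 := by
    rw [inv_mul_le_iff₀ (by linarith)]
    linarith
  rw [Real.enorm_of_nonneg (inv_nonneg.2 (by linarith)), ← ENNReal.ofReal_natCast,
    ← ENNReal.ofReal_mul (inv_nonneg.2 (by linarith))]
  simpa only [ENNReal.ofReal_ofNat] using ENNReal.ofReal_le_ofReal h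

namespace IsTypicalSample

lemma sq_le_self (h : IsTypicalSample e c x N η) : (η : ℝ≥0∞) ^ 2 ≤ η :=
  pow_le_of_le_one zero_le (by exact_mod_cast h.le_one) two_ne_zero

lemma l1Norm_empCov_sub_le (h : IsTypicalSample e c x N η) :
    l1Norm (outerBasis e e) (empCov x (Finset.range N) - c) ≤ 2 * η :=
  calc l1Norm (outerBasis e e) (empCov x (Finset.range N) - c)
      ≤ η + (η : ℝ≥0∞) ^ 2 := (SepBand.l1Norm_empCov_sub_le e c x _).trans
        (add_le_add h.secondMoment_sub_le (pow_le_pow_left' h.sampleMean_le 2))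
    _ ≤ η + η := by gcongr; exact h.sq_le_self
    _ = 2 * η := (two_mul _).symm

lemma l1Norm_le (h : IsTypicalSample e c x N η) {n : ℕ} (hn : n < N) :
    l1Norm e (x n) ≤ η * N := by
  refine (ENNReal.pow_le_pow_left_iff two_ne_zero).1 ((h.sq_le n hn).trans ?_)
  rw [mul_pow]
  gcongr
  exact_mod_cast Nat.le_self_pow two_ne_zero N

lemma l1Norm_sampleMean_erase_le (h : IsTypicalSample e c x N η) {n : ℕ} (hn : n < N) :
    l1Norm e (sampleMean x ((Finset.range N).erase n)) ≤ 4 * η := by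
  rw [sampleMean_erase x (by have := h.two_le; omega) hn, l1Norm_smul]
  calc ‖((N : ℝ) - 1)⁻¹‖ₑ * l1Norm e ((N : ℝ) • sampleMean x (Finset.range N) - x n)
      ≤ ‖((N : ℝ) - 1)⁻¹‖ₑ * (N * η + η * N) := by
        gcongr
        refine (l1Norm_sub_le e _ _).trans (add_le_add ?_ (h.l1Norm_le hn))
        rw [l1Norm_smul, Real.enorm_natCast]
        gcongr
        exact h.sampleMean_le
    _ = ‖((N : ℝ) - 1)⁻¹‖ₑ * N * (2 * η) := by ring
    _ ≤ 2 * (2 * η) := by gcongr; exact enorm_inv_natCast_sub_one_mul_le h.two_le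
    _ = 4 * η := by ring

lemma l1Norm_secondMoment_erase_sub_le (h : IsTypicalSample e c x N η) {n : ℕ} (hn : n < N) :
    l1Norm (outerBasis e e) (secondMoment x ((Finset.range N).erase n) - c) ≤ 6 * η := by
  rw [secondMoment_erase_sub x c h.two_le hn, l1Norm_smul]
  calc ‖((N : ℝ) - 1)⁻¹‖ₑ * l1Norm (outerBasis e e)
        ((N : ℝ) • (secondMoment x (Finset.range N) - c) + c - outer (x n) (x n))
      ≤ ‖((N : ℝ) - 1)⁻¹‖ₑ * (N * η + η * N + η * N) := by
        gcongr
        refine (l1Norm_sub_le _ _ _).trans (add_le_add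
          ((l1Norm_add_le _ _ _).trans (add_le_add ?_ h.covariance_le)) ?_)
        · rw [l1Norm_smul, Real.enorm_natCast]
          gcongr
          exact h.secondMoment_sub_le
        · rw [l1Norm_outerBasis_outer, ← pow_two]
          refine (h.sq_le n hn).trans ?_
          gcongr
          exact h.sq_le_self
    _ = ‖((N : ℝ) - 1)⁻¹‖ₑ * N * (3 * η) := by ring
    _ ≤ 2 * (3 * η) := by gcongr; exact enorm_inv_natCast_sub_one_mul_le h.two_le
    _ = 6 * η := by ring

lemma l1Norm_empCov_erase_sub_le (h : IsTypicalSample e c x N η) {n : ℕ} (hn : n < N) :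
    l1Norm (outerBasis e e) (empCov x ((Finset.range N).erase n) - c) ≤ 22 * η :=
  calc l1Norm (outerBasis e e) (empCov x ((Finset.range N).erase n) - c)
      ≤ 6 * η + (4 * (η : ℝ≥0∞)) ^ 2 := (SepBand.l1Norm_empCov_sub_le e c x _).trans
        (add_le_add (h.l1Norm_secondMoment_erase_sub_le hn)
          (pow_le_pow_left' (h.l1Norm_sampleMean_erase_le hn) 2))
    _ = 6 * η + 16 * (η : ℝ≥0∞) ^ 2 := by ring
    _ ≤ 6 * η + 16 * η := by gcongr; exact h.sq_le_self
    _ = 22 * η := by ring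

lemma inv_mul_sum_norm_sq_le (h : IsTypicalSample e c x N η)
    (hc : l1Norm (outerBasis e e) c ≠ ∞) :
    (N : ℝ)⁻¹ * ∑ n ∈ Finset.range N, ‖x n‖ ^ 2 ≤ (l1Norm (outerBasis e e) c).toReal + η := by
  have henorm : ‖(N : ℝ)⁻¹‖ₑ * ∑ n ∈ Finset.range N, ‖x n‖ₑ ^ 2
      ≤ l1Norm (outerBasis e e) c + η :=
    calc ‖(N : ℝ)⁻¹‖ₑ * ∑ n ∈ Finset.range N, ‖x n‖ₑ ^ 2
        ≤ ‖(N : ℝ)⁻¹‖ₑ * l1Norm (outerBasis e e) (∑ n ∈ Finset.range N, outer (x n) (x n)) := by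
          gcongr
          exact sum_enorm_sq_le_l1Norm e x _
      _ = l1Norm (outerBasis e e) (c + (secondMoment x (Finset.range N) - c)) := by
          rw [add_sub_cancel, secondMoment, l1Norm_smul, Finset.card_range]
      _ ≤ l1Norm (outerBasis e e) c + η :=
          (l1Norm_add_le _ _ _).trans (by gcongr; exact h.secondMoment_sub_le)
  simpa [ENNReal.toReal_add, hc, ENNReal.toReal_mul, ENNReal.toReal_sum, toReal_enorm] using
    ENNReal.toReal_mono (ENNReal.add_ne_top.2 ⟨hc, ENNReal.coe_ne_top⟩) henorm

end IsTypicalSample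

end EmpCov

section CrossValidation

variable {e : HilbertBasis ℕ ℝ Surface} {c : SurfaceOp} {x : ℕ → Surface} {N : ℕ} {η : ℝ≥0} {δ : ℝ}

lemma abs_norm_sq_sub_norm_sq_le {E : Type*} [SeminormedAddCommGroup E] {p p' : E} {ρ : ℝ}
    (h : ‖p' - p‖ ≤ ρ) (hρ : ρ ≤ 1) : |‖p'‖ ^ 2 - ‖p‖ ^ 2| ≤ ρ * (2 * ‖p‖ + 1) := by
  have hdiff : |‖p'‖ - ‖p‖| ≤ ρ := (abs_norm_sub_norm_le _ _).trans h
  rw [sq_sub_sq, abs_mul, abs_of_nonneg (by positivity), mul_comm]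
  have : ‖p'‖ + ‖p‖ ≤ 2 * ‖p‖ + 1 := by linarith [le_abs_self (‖p'‖ - ‖p‖)]
  gcongr
  exact (abs_nonneg _).trans hdiff

lemma abs_sum_inner_outer_le {S : Finset ℕ} {q : ℕ → SurfaceOp} {ρ : ℝ} (x : ℕ → Surface)
    (hq : ∀ n ∈ S, ‖q n‖ ≤ ρ) :
    |∑ n ∈ S, ⟪q n, outer (x n) (x n)⟫_ℝ| ≤ ρ * ∑ n ∈ S, ‖x n‖ ^ 2 := by
  rw [Finset.mul_sum]
  refine (Finset.abs_sum_le_sum_abs _ _).trans (Finset.sum_le_sum fun n hn => ?_)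
  refine (abs_real_inner_le_norm _ _).trans ?_
  rw [norm_outer, ← pow_two]
  gcongr
  exact hq n hn

-- `Ξ(δ) - ‖c‖² = ‖p‖² - 2⟨p, c⟩` for `p = proxy δ c`; the criterion estimates each of the two
-- terms.
lemma cvCriterion_sub_eq (x : ℕ → Surface) (N : ℕ) (c : SurfaceOp) (δ : ℝ) :
    cvCriterion x N δ - (theoreticalCriterion c δ - ‖c‖ ^ 2) =
      ‖proxy δ (empCov x (Finset.range N))‖ ^ 2 - ‖proxy δ c‖ ^ 2
        - 2 * ((N : ℝ)⁻¹ * ∑ n ∈ Finset.range N,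
            ⟪proxy δ (empCov x ((Finset.range N).erase n)) - proxy δ c, outer (x n) (x n)⟫_ℝ
          + ⟪proxy δ c, secondMoment x (Finset.range N) - c⟫_ℝ) := by
  rw [cvCriterion, theoreticalCriterion, norm_sub_sq_real, secondMoment, inner_sub_right,
    inner_smul_right, inner_sum, Finset.card_range]
  simp only [inner_sub_left, Finset.sum_sub_distrib]
  ring

lemma IsTypicalSample.abs_cvCriterion_sub_le (h : IsTypicalSample e c x N η)
    (hc : l1Norm (outerBasis e e) c ≠ ∞) {ρ : ℝ} (hρ : ρ ≤ 1)
    (hfull : ‖proxy δ (empCov x (Finset.range N)) - proxy δ c‖ ≤ ρ)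
    (hleave : ∀ n < N, ‖proxy δ (empCov x ((Finset.range N).erase n)) - proxy δ c‖ ≤ ρ) :
    |cvCriterion x N δ - (theoreticalCriterion c δ - ‖c‖ ^ 2)| ≤
      ρ * (2 * ‖proxy δ c‖ + 1)
        + 2 * (ρ * ((l1Norm (outerBasis e e) c).toReal + η) + ‖proxy δ c‖ * η) := by
  have hρ0 : 0 ≤ ρ := (norm_nonneg _).trans hfull
  have hmean : |(N : ℝ)⁻¹ * ∑ n ∈ Finset.range N,
      ⟪proxy δ (empCov x ((Finset.range N).erase n)) - proxy δ c, outer (x n) (x n)⟫_ℝ|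
        ≤ ρ * ((l1Norm (outerBasis e e) c).toReal + η) := by
    rw [abs_mul, abs_of_nonneg (by positivity)]
    calc (N : ℝ)⁻¹ * _ ≤ (N : ℝ)⁻¹ * (ρ * ∑ n ∈ Finset.range N, ‖x n‖ ^ 2) := by
          gcongr
          exact abs_sum_inner_outer_le x fun n hn => hleave n (Finset.mem_range.1 hn)
      _ = ρ * ((N : ℝ)⁻¹ * ∑ n ∈ Finset.range N, ‖x n‖ ^ 2) := by ring
      _ ≤ _ := by gcongr; exact h.inv_mul_sum_norm_sq_le hc
  have hmoment : |⟪proxy δ c, secondMoment x (Finset.range N) - c⟫_ℝ| ≤ ‖proxy δ c‖ * η := by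
    refine (abs_real_inner_le_norm _ _).trans ?_
    gcongr
    exact norm_le_of_l1Norm_le _ h.secondMoment_sub_le
  rw [cvCriterion_sub_eq]
  refine (abs_sub _ _).trans (add_le_add (abs_norm_sq_sub_norm_sq_le hfull hρ) ?_)
  rw [abs_mul, abs_two]
  gcongr
  exact (abs_add_le _ _).trans (add_le_add hmean hmoment)

lemma exists_norm_proxy_sub_le (hc : l1Norm (outerBasis e e) c ≠ ∞) (ht : shiftedTrace δ c ≠ 0) :
    ∃ L : ℝ≥0, ∀ᶠ r : ℝ≥0 in 𝓝 0, ∀ k, l1Norm (outerBasis e e) (k - c) ≤ r →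
      ‖proxy δ k - proxy δ c‖ ≤ L * r := by
  have hnuc := hasNuclearBound_of_l1Norm_le e e (ENNReal.coe_toNNReal hc).ge
  obtain ⟨L, hL⟩ := exists_norm_separablePart_sub_le hnuc ht
  refine ⟨1 + 2 * L, hL.mono fun r hr k hk => ?_⟩
  have hsep := hr k (hasNuclearBound_of_l1Norm_le e e hk)
  have hnorm := norm_le_of_l1Norm_le _ hk
  push_cast
  linarith [norm_proxy_sub_le δ k c]

lemma eventually_abs_cvCriterion_sub_lt (hc : l1Norm (outerBasis e e) c ≠ ∞)
    (ht : shiftedTrace δ c ≠ 0) {ε : ℝ} (hε : 0 < ε) :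
    ∀ᶠ η : ℝ≥0 in 𝓝 0, ∀ (x : ℕ → Surface) (N : ℕ), IsTypicalSample e c x N η →
      |cvCriterion x N δ - (theoreticalCriterion c δ - ‖c‖ ^ 2)| < ε := by
  obtain ⟨L, hL⟩ := exists_norm_proxy_sub_le hc ht
  have hlt {f : ℝ≥0 → ℝ} (hf : Continuous f) (hf0 : f 0 = 0) {t : ℝ} (ht : 0 < t) :
      ∀ᶠ η in 𝓝 0, f η < t := hf.continuousAt.eventually_lt continuousAt_const (by rwa [hf0])
  have hscale : Tendsto (fun η : ℝ≥0 => 22 * η) (𝓝 0) (𝓝 0) := by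
    simpa using (continuous_const_mul (22 : ℝ≥0)).tendsto 0
  filter_upwards [hscale.eventually hL,
    hlt (f := fun η => L * (22 * η)) (by fun_prop) (by simp) one_pos,
    hlt (f := fun η => L * (22 * η) * (2 * ‖proxy δ c‖ + 1) + 2 * (L * (22 * η)
      * ((l1Norm (outerBasis e e) c).toReal + η) + ‖proxy δ c‖ * η)) (by fun_prop) (by simp) hε]
    with η hlip hρ hsmall x N h
  have hproxy (k) (hk : l1Norm (outerBasis e e) (k - c) ≤ 22 * η) :
      ‖proxy δ k - proxy δ c‖ ≤ L * (22 * η) := by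
    simpa using hlip k (by simpa using hk)
  refine (h.abs_cvCriterion_sub_le hc hρ.le (hproxy _ ?_) fun n hn =>
    hproxy _ (h.l1Norm_empCov_erase_sub_le hn)).trans_lt hsmall
  exact h.l1Norm_empCov_sub_le.trans (by gcongr; norm_num)

lemma eventually_le_of_mem_argminOn_cvCriterion (hc : l1Norm (outerBasis e e) c ≠ ∞)
    {Δ : Finset ℝ} {δstar : ℝ} (ht : ∀ δ ∈ Δ, shiftedTrace δ c ≠ 0)
    (hzero : ∃ δ ∈ Δ, theoreticalCriterion c δ = 0)
    (hmin : δstar ∈ lowerBounds (argminOn Δ (theoreticalCriterion c))) :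
    ∀ᶠ η : ℝ≥0 in 𝓝 0, ∀ (x : ℕ → Surface) (N : ℕ), IsTypicalSample e c x N η →
      ∀ δ ∈ argminOn Δ (cvCriterion x N), δstar ≤ δ := by
  obtain ⟨δ₀, hδ₀, hz⟩ := hzero
  have hnonneg (δ) : 0 ≤ theoreticalCriterion c δ := sq_nonneg _
  suffices h : ∀ δ ∈ Δ, ∀ᶠ η : ℝ≥0 in 𝓝 0, ∀ (x : ℕ → Surface) (N : ℕ),
      IsTypicalSample e c x N η → δ ∈ argminOn Δ (cvCriterion x N) → δstar ≤ δ by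
    filter_upwards [(eventually_all_finset Δ).2 h] with η hη x N hx δ hδ
    exact hη δ hδ.1 x N hx hδ
  intro δ hδ
  obtain h0 | hpos := (hnonneg δ).eq_or_lt
  · exact .of_forall fun _ _ _ _ _ => hmin ⟨hδ, fun δ' _ => h0 ▸ hnonneg δ'⟩
  · filter_upwards [eventually_abs_cvCriterion_sub_lt hc (ht δ hδ) (half_pos hpos),
      eventually_abs_cvCriterion_sub_lt hc (ht δ₀ hδ₀) (half_pos hpos)] with η h h₀ x N hx hmem
    linarith [(abs_lt.1 (h x N hx)).1, (abs_lt.1 (h₀ x N hx)).2, hmem.2 δ₀ hδ₀]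

end CrossValidation

section Selection

variable {a₁ a₂ : CurveOp} {b : SurfaceOp} {δstar : ℝ}

lemma exists_norm_estimators_sub_le {e : HilbertBasis ℕ ℝ Surface}
    (h₁ : IsTraceClass a₁) (h₂ : IsTraceClass a₂) (hb : IsTraceClass b)
    (hstat : b ∈ stationary) (hband : IsBanded δstar b)
    (hc : l1Norm (outerBasis e e) (opTensor a₁ a₂ + b) ≠ ∞) {Δ : Finset ℝ}
    (htrace : ∀ δ ∈ Δ, shiftedTrace δ (opTensor a₁ a₂ + b) ≠ 0) (hgrid : ∃ δ ∈ Δ, δstar ≤ δ)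
    (hmin : δstar ∈ lowerBounds (argminOn Δ (theoreticalCriterion (opTensor a₁ a₂ + b)))) :
    ∃ η ∈ Set.Ioc (0 : ℝ≥0) 1, ∃ L : ℝ≥0, ∀ᶠ r : ℝ≥0 in 𝓝 0, ∀ (x : ℕ → Surface) (N : ℕ),
      IsTypicalSample e (opTensor a₁ a₂ + b) x N η →
      l1Norm (outerBasis e e) (empCov x (Finset.range N) - (opTensor a₁ a₂ + b)) ≤ r →
      ∀ δ ∈ argminOn Δ (cvCriterion x N),
        ‖separablePart δ (empCov x (Finset.range N)) - opTensor a₁ a₂‖ ≤ L * r ∧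
        ‖bandedPart δ (empCov x (Finset.range N)) - b‖ ≤ L * r := by
  have hsep (δ) (hδ : δ ∈ Δ) (hle : δstar ≤ δ) :=
    separablePart_opTensor_add h₁ h₂ hb hband hle (htrace δ hδ)
  have hzero : ∃ δ ∈ Δ, theoreticalCriterion (opTensor a₁ a₂ + b) δ = 0 :=
    hgrid.imp fun δ h => ⟨h.1, theoreticalCriterion_opTensor_add hstat (hsep δ h.1 h.2)⟩
  obtain ⟨η, hselect, hη⟩ := (((eventually_le_of_mem_argminOn_cvCriterion hc htrace hzero
    hmin).filter_mono nhdsWithin_le_nhds).and (Ioc_mem_nhdsGT one_pos)).exists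
  obtain ⟨L, hL⟩ := exists_norm_separablePart_sub_le_finset
    (hasNuclearBound_of_l1Norm_le e e (ENNReal.coe_toNNReal hc).ge) htrace
  refine ⟨η, hη, 1 + L, hL.mono fun r hr x N hx hk δ hδ => ?_⟩
  have hsepδ := hsep δ hδ.1 (hselect x N hx δ hδ)
  have hsepLip := hr _ (hasNuclearBound_of_l1Norm_le e e hk) δ hδ.1
  have hbandLip := norm_bandedPart_sub_le δ (empCov x (Finset.range N)) (opTensor a₁ a₂ + b)
  rw [bandedPart_opTensor_add hstat hsepδ] at hbandLip
  rw [hsepδ] at hsepLip hbandLip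
  have hnorm := norm_le_of_l1Norm_le _ hk
  push_cast
  constructor <;> nlinarith [r.2]

end Selection

section MomentSum

variable {Ω : Type*} [MeasurableSpace Ω] {P : Measure Ω}
  {ι H : Type*} [NormedAddCommGroup H] [InnerProductSpace ℝ H]

/-- The moment sum `∑ⱼ (E |⟨Y, bⱼ⟩|ᵖ)^{1/p}` of a random element `Y` in the orthonormal basis `b`.
It bounds the `Lᵖ` norm of the random variable `l1Norm b Y`. -/
def momentSum (b : HilbertBasis ι ℝ H) (p : ℝ≥0∞) (P : Measure Ω) (Y : Ω → H) : ℝ≥0∞ :=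
  ∑' j, eLpNorm (fun ω => ⟪Y ω, b j⟫_ℝ) p P

variable {b : HilbertBasis ι ℝ H} {Y : Ω → H}

lemma momentSum_le_of_exponent_le [IsProbabilityMeasure P] {p q : ℝ≥0∞} (hpq : p ≤ q)
    (hY : AEStronglyMeasurable Y P) : momentSum b p P Y ≤ momentSum b q P Y := by
  unfold momentSum
  gcongr with j
  exact eLpNorm_le_eLpNorm_of_exponent_le hpq (hY.inner aestronglyMeasurable_const)

lemma measurable_l1Norm [Countable ι] [MeasurableSpace H] [OpensMeasurableSpace H]
    (b : HilbertBasis ι ℝ H) : Measurable (l1Norm b) :=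
  Measurable.tsum fun _ => ((continuous_id.inner continuous_const).measurable).enorm

lemma lintegral_l1Norm [Countable ι] (hY : AEStronglyMeasurable Y P) :
    ∫⁻ ω, l1Norm b (Y ω) ∂P = momentSum b 1 P Y := by
  simp only [l1Norm, momentSum, eLpNorm_one_eq_lintegral_enorm]
  exact lintegral_tsum fun j => (hY.inner aestronglyMeasurable_const).enorm

lemma integrable_of_momentSum_ne_top [Countable ι] (hY : AEStronglyMeasurable Y P)
    (h : momentSum b 1 P Y ≠ ∞) : Integrable Y P :=
  ⟨hY, calc ∫⁻ ω, ‖Y ω‖ₑ ∂P ≤ ∫⁻ ω, l1Norm b (Y ω) ∂P := by gcongr; exact enorm_le_l1Norm b _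
    _ = momentSum b 1 P Y := lintegral_l1Norm hY
    _ < ∞ := h.lt_top⟩

lemma integral_inner_right [CompleteSpace H] (hY : Integrable Y P) (f : H) :
    ∫ ω, ⟪Y ω, f⟫_ℝ ∂P = ⟪∫ ω, Y ω ∂P, f⟫_ℝ := by
  simp only [real_inner_comm f, integral_inner hY]

lemma l1Norm_integral_le [Countable ι] [CompleteSpace H] (hY : AEStronglyMeasurable Y P)
    (h : momentSum b 1 P Y ≠ ∞) : l1Norm b (∫ ω, Y ω ∂P) ≤ momentSum b 1 P Y := by
  simp only [l1Norm, momentSum, eLpNorm_one_eq_lintegral_enorm,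
    ← integral_inner_right (integrable_of_momentSum_ne_top hY h)]
  gcongr
  exact enorm_integral_le_lintegral_enorm _

lemma lintegral_enorm_mul_enorm_le {f g : Ω → ℝ} (hf : AEStronglyMeasurable f P)
    (hg : AEStronglyMeasurable g P) :
    ∫⁻ ω, ‖f ω‖ₑ * ‖g ω‖ₑ ∂P ≤ eLpNorm f 2 P * eLpNorm g 2 P := by
  simpa only [eLpNorm_one_eq_lintegral_enorm, smul_eq_mul, Pi.mul_apply, enorm_mul] using
    eLpNorm_smul_le_mul_eLpNorm (p := 2) (q := 2) (r := 1) hg hf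

lemma lintegral_l1Norm_sq_le [Countable ι] (hY : AEStronglyMeasurable Y P) :
    ∫⁻ ω, l1Norm b (Y ω) ^ 2 ∂P ≤ momentSum b 2 P Y ^ 2 := by
  have hcoord (j) : AEStronglyMeasurable (fun ω => ⟪Y ω, b j⟫_ℝ) P :=
    hY.inner aestronglyMeasurable_const
  have hmeas (i j) : AEMeasurable (fun ω => ‖⟪Y ω, b i⟫_ℝ‖ₑ * ‖⟪Y ω, b j⟫_ℝ‖ₑ) P :=
    (hcoord i).enorm.mul (hcoord j).enorm
  simp only [l1Norm, momentSum, pow_two, ← ENNReal.tsum_mul_right]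
  simp only [← ENNReal.tsum_mul_left]
  rw [lintegral_tsum fun i => AEMeasurable.tsum fun j => hmeas i j]
  gcongr with i
  rw [lintegral_tsum fun j => hmeas i j]
  gcongr with j
  exact lintegral_enorm_mul_enorm_le (hcoord i) (hcoord j)

lemma momentSum_outerBasis_outer_le {α β κ : Type*} [MeasureSpace α] [MeasureSpace β]
    [IsFiniteMeasure (volume : Measure α)] [IsFiniteMeasure (volume : Measure β)]
    (b : HilbertBasis ι ℝ (L2 α)) (c : HilbertBasis κ ℝ (L2 β)) {p q r : ℝ≥0∞}
    [ENNReal.HolderTriple p q r] {Y : Ω → L2 α} {Z : Ω → L2 β} (hY : AEStronglyMeasurable Y P)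
    (hZ : AEStronglyMeasurable Z P) :
    momentSum (outerBasis b c) r P (fun ω => outer (Y ω) (Z ω)) ≤
      momentSum b p P Y * momentSum c q P Z := by
  simp only [momentSum, ENNReal.tsum_prod', outerBasis_apply, inner_outer_outer,
    ← ENNReal.tsum_mul_right]
  simp only [← ENNReal.tsum_mul_left]
  gcongr with i j
  exact eLpNorm_smul_le_mul_eLpNorm (f := fun ω => ⟪Z ω, c j⟫_ℝ) (φ := fun ω => ⟪Y ω, b i⟫_ℝ)
    (hZ.inner aestronglyMeasurable_const) (hY.inner aestronglyMeasurable_const)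

end MomentSum

section SampleAverage

variable {Ω : Type*} [MeasurableSpace Ω] {P : Measure Ω}

lemma sq_lintegral_enorm_sub_integral_le [IsProbabilityMeasure P] {f : Ω → ℝ}
    (hf : AEStronglyMeasurable f P) :
    (∫⁻ ω, ‖f ω - ∫ ω', f ω' ∂P‖ₑ ∂P) ^ 2 ≤ evariance f P := by
  set g : Ω → ℝ := fun ω => f ω - ∫ ω', f ω' ∂P
  have hg : AEStronglyMeasurable g P := hf.sub aestronglyMeasurable_const
  calc (∫⁻ ω, ‖g ω‖ₑ ∂P) ^ 2 ≤ eLpNorm g 2 P ^ 2 := by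
        rw [← eLpNorm_one_eq_lintegral_enorm]
        gcongr
        exact eLpNorm_le_eLpNorm_of_exponent_le one_le_two hg
    _ = evariance f P := by
        simpa using! eLpNorm_nnreal_pow_eq_lintegral (μ := P) (f := g) (p := 2) two_ne_zero

lemma evariance_le_eLpNorm_sq [IsProbabilityMeasure P] {f : Ω → ℝ}
    (hf : AEStronglyMeasurable f P) :
    evariance f P ≤ eLpNorm f 2 P ^ 2 := by
  rw [evariance_def' hf]
  refine tsub_le_self.trans_eq ?_
  simpa using (eLpNorm_nnreal_pow_eq_lintegral (μ := P) (f := f) (p := 2) two_ne_zero).symm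

section Real

variable {Z : ℕ → Ω → ℝ} {N : ℕ}

lemma integral_average_eq (hident : ∀ n, IdentDistrib (Z n) (Z 0) P P) (hZ : Integrable (Z 0) P)
    (hN : N ≠ 0) :
    ∫ ω, (N : ℝ)⁻¹ * (∑ n ∈ Finset.range N, Z n) ω ∂P = ∫ ω, Z 0 ω ∂P := by
  simp only [integral_const_mul, Finset.sum_apply]
  rw [integral_finsetSum _ fun n _ => (hident n).integrable_iff.2 hZ]
  simp only [fun n => (hident n).integral_eq, Finset.sum_const, Finset.card_range, nsmul_eq_mul]
  exact inv_mul_cancel_left₀ (Nat.cast_ne_zero.2 hN) _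

lemma evariance_average_eq [IsProbabilityMeasure P]
    (hindep : Pairwise fun i j => IndepFun (Z i) (Z j) P)
    (hident : ∀ n, IdentDistrib (Z n) (Z 0) P P) (hZ : MemLp (Z 0) 2 P) (hN : N ≠ 0) :
    evariance (fun ω => (N : ℝ)⁻¹ * (∑ n ∈ Finset.range N, Z n) ω) P
      = (N : ℝ≥0∞)⁻¹ * evariance (Z 0) P := by
  have hZn (n) : MemLp (Z n) 2 P := (hident n).memLp_iff.2 hZ
  have hvar : variance (∑ n ∈ Finset.range N, Z n) P = N * variance (Z 0) P := by
    rw [IndepFun.variance_sum (fun n _ => hZn n) fun i _ j _ hij => hindep hij]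
    simp only [fun n => (hident n).variance_eq, Finset.sum_const, Finset.card_range, nsmul_eq_mul]
  rw [evariance_mul, ← ofReal_variance (memLp_finsetSum' _ fun n _ => hZn n), hvar,
    ← ofReal_variance hZ, ENNReal.ofReal_mul (Nat.cast_nonneg N),
    ENNReal.ofReal_pow (by positivity), ENNReal.ofReal_inv_of_pos (by positivity),
    ENNReal.ofReal_natCast, ← mul_assoc, pow_two,
    ENNReal.inv_mul_cancel_right (Nat.cast_ne_zero.2 hN) (ENNReal.natCast_ne_top N)]

lemma coe_inv_sqrt_natCast_sq (N : ℕ) :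
    (((NNReal.sqrt N)⁻¹ : ℝ≥0) : ℝ≥0∞) ^ 2 = ((N : ℝ≥0)⁻¹ : ℝ≥0) := by
  rw [← ENNReal.coe_pow, inv_pow, NNReal.sq_sqrt]

lemma lintegral_enorm_average_sub_le [IsProbabilityMeasure P]
    (hindep : Pairwise fun i j => IndepFun (Z i) (Z j) P)
    (hident : ∀ n, IdentDistrib (Z n) (Z 0) P P) (hZ : MemLp (Z 0) 2 P) (hN : N ≠ 0) :
    ∫⁻ ω, ‖(N : ℝ)⁻¹ * ∑ n ∈ Finset.range N, Z n ω - ∫ ω', Z 0 ω' ∂P‖ₑ ∂P ≤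
      ((NNReal.sqrt N)⁻¹ : ℝ≥0) * eLpNorm (Z 0) 2 P := by
  have hmeas : AEStronglyMeasurable (fun ω => (N : ℝ)⁻¹ * (∑ n ∈ Finset.range N, Z n) ω) P :=
    (Finset.aestronglyMeasurable_sum _ fun n _ => ((hident n).memLp_iff.2 hZ).1).const_mul _
  have hdev := sq_lintegral_enorm_sub_integral_le hmeas
  rw [integral_average_eq hident (hZ.integrable one_le_two) hN,
    evariance_average_eq hindep hident hZ hN] at hdev
  refine (ENNReal.pow_le_pow_left_iff two_ne_zero).1 ?_
  rw [mul_pow, coe_inv_sqrt_natCast_sq, ENNReal.coe_inv (Nat.cast_ne_zero.2 hN)]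
  simp only [Finset.sum_apply] at hdev
  refine hdev.trans ?_
  gcongr
  · simp
  · exact evariance_le_eLpNorm_sq hZ.1

end Real

variable {ι H : Type*} [Countable ι] [NormedAddCommGroup H] [InnerProductSpace ℝ H]
  {b : HilbertBasis ι ℝ H}

lemma secondCountableTopology_of_hilbertBasis (b : HilbertBasis ι ℝ H) :
    SecondCountableTopology H := by
  have hsep : TopologicalSpace.IsSeparable (Set.univ : Set H) := by
    simpa only [← Submodule.topologicalClosure_coe, b.dense_span, Submodule.top_coe] using
      ((Set.countable_range b).isSeparable.span (R := ℝ)).closure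
  have := TopologicalSpace.isSeparable_univ_iff.1 hsep
  exact UniformSpace.secondCountable_of_separable H

variable [MeasurableSpace H] [BorelSpace H] {Z : ℕ → Ω → H}

lemma lintegral_l1Norm_average_sub_le [CompleteSpace H] [IsProbabilityMeasure P]
    (hindep : Pairwise fun i j => IndepFun (Z i) (Z j) P)
    (hident : ∀ n, IdentDistrib (Z n) (Z 0) P P) (hZ : momentSum b 2 P (Z 0) ≠ ∞) {N : ℕ}
    (hN : N ≠ 0) :
    ∫⁻ ω, l1Norm b ((N : ℝ)⁻¹ • ∑ n ∈ Finset.range N, Z n ω - ∫ ω', Z 0 ω' ∂P) ∂P ≤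
      ((NNReal.sqrt N)⁻¹ : ℝ≥0) * momentSum b 2 P (Z 0) := by
  have := secondCountableTopology_of_hilbertBasis b
  have hmeas (n) : AEStronglyMeasurable (Z n) P := (hident n).aemeasurable_fst.aestronglyMeasurable
  have hint : Integrable (Z 0) P := integrable_of_momentSum_ne_top (hmeas 0)
    (ne_top_of_le_ne_top hZ (momentSum_le_of_exponent_le one_le_two (hmeas 0)))
  have hcoord (j) : Measurable fun z : H => ⟪z, b j⟫_ℝ :=
    (continuous_id.inner continuous_const).measurable
  have hmemLp (j) : MemLp (fun ω => ⟪Z 0 ω, b j⟫_ℝ) 2 P :=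
    ⟨(hmeas 0).inner aestronglyMeasurable_const,
      (ENNReal.le_tsum (f := fun j => eLpNorm (fun ω => ⟪Z 0 ω, b j⟫_ℝ) 2 P) j).trans_lt hZ.lt_top⟩
  have hdev : AEStronglyMeasurable
      (fun ω => (N : ℝ)⁻¹ • ∑ n ∈ Finset.range N, Z n ω - ∫ ω', Z 0 ω' ∂P) P :=
    ((Finset.aestronglyMeasurable_fun_sum _ fun n _ => hmeas n).const_smul (N : ℝ)⁻¹).sub
      aestronglyMeasurable_const
  rw [lintegral_l1Norm hdev]
  simp only [momentSum, ← ENNReal.tsum_mul_left, eLpNorm_one_eq_lintegral_enorm, inner_sub_left,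
    real_inner_smul_left, sum_inner, ← integral_inner_right hint]
  gcongr with j
  exact lintegral_enorm_average_sub_le (Z := fun n ω => ⟪Z n ω, b j⟫_ℝ)
    (fun m n hmn => (hindep hmn).comp (hcoord j) (hcoord j))
    (fun n => (hident n).comp (hcoord j)) (hmemLp j) hN

lemma exists_measure_lt_l1Norm_average_sub_le [CompleteSpace H] [IsProbabilityMeasure P]
    (hindep : Pairwise fun i j => IndepFun (Z i) (Z j) P)
    (hident : ∀ n, IdentDistrib (Z n) (Z 0) P P) (hZ : momentSum b 2 P (Z 0) ≠ ∞) {ε : ℝ≥0∞}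
    (hε : ε ≠ 0) :
    ∃ R : ℝ≥0, ∀ N : ℕ, N ≠ 0 →
      P {ω | (R * (NNReal.sqrt N)⁻¹ : ℝ≥0) <
        l1Norm b ((N : ℝ)⁻¹ • ∑ n ∈ Finset.range N, Z n ω - ∫ ω', Z 0 ω' ∂P)} ≤ ε := by
  have := secondCountableTopology_of_hilbertBasis b
  lift momentSum b 2 P (Z 0) / ε to ℝ≥0 using ENNReal.div_ne_top hZ hε with R hR
  refine ⟨R + 1, fun N hN => ?_⟩
  set s : ℝ≥0 := (NNReal.sqrt N)⁻¹
  have hs : s ≠ 0 := inv_ne_zero (by simpa using hN)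
  have hmeas : AEMeasurable (fun ω => l1Norm b
      ((N : ℝ)⁻¹ • ∑ n ∈ Finset.range N, Z n ω - ∫ ω', Z 0 ω' ∂P)) P :=
    (measurable_l1Norm b).comp_aemeasurable
      (((Finset.aemeasurable_fun_sum _ fun n _ => (hident n).aemeasurable_fst).const_smul _).sub
        aemeasurable_const)
  have hthreshold : ((R + 1) * s : ℝ≥0) ≠ 0 := mul_ne_zero (by positivity) hs
  refine (measure_mono (Set.ofPred_subset_ofPred.2 fun _ => le_of_lt)).trans
    ((meas_ge_le_lintegral_div hmeas (ENNReal.coe_ne_zero.2 hthreshold) ENNReal.coe_ne_top).trans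
      (ENNReal.div_le_of_le_mul ?_))
  refine (lintegral_l1Norm_average_sub_le hindep hident hZ hN).trans ?_
  have hm : momentSum b 2 P (Z 0) ≤ ε * (R + 1 : ℝ≥0) := by
    rw [mul_comm, ← ENNReal.div_le_iff_le_mul (.inl hε)
      (.inr (ENNReal.coe_ne_zero.2 (by positivity))), ← hR]
    exact_mod_cast le_self_add
  calc s * momentSum b 2 P (Z 0) ≤ s * (ε * (R + 1 : ℝ≥0)) := by gcongr
    _ = ε * ((R + 1) * s : ℝ≥0) := by push_cast; ring

lemma measure_lt_l1Norm_le (hident : ∀ n, IdentDistrib (Z n) (Z 0) P P) (n : ℕ) {t : ℝ≥0}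
    (ht : t ≠ 0) : P {ω | t < l1Norm b (Z n ω)} ≤ momentSum b 2 P (Z 0) ^ 2 / t ^ 2 := by
  have := secondCountableTopology_of_hilbertBasis b
  have hsq : Measurable fun z => l1Norm b z ^ 2 := (measurable_l1Norm b).pow_const 2
  calc P {ω | t < l1Norm b (Z n ω)} ≤ P {ω | (t : ℝ≥0∞) ^ 2 ≤ l1Norm b (Z n ω) ^ 2} :=
        measure_mono fun ω hω => pow_le_pow_left' (le_of_lt hω) 2
    _ ≤ (∫⁻ ω, l1Norm b (Z n ω) ^ 2 ∂P) / t ^ 2 :=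
        meas_ge_le_lintegral_div (hsq.comp_aemeasurable (hident n).aemeasurable_fst)
          (by simpa using ht) (by simp)
    _ = (∫⁻ ω, l1Norm b (Z 0 ω) ^ 2 ∂P) / t ^ 2 := by
        congr 1
        exact ((hident n).comp hsq).lintegral_eq
    _ ≤ momentSum b 2 P (Z 0) ^ 2 / t ^ 2 := by
        gcongr
        exact lintegral_l1Norm_sq_le (hident 0).aemeasurable_fst.aestronglyMeasurable

lemma eventually_measure_exists_lt_l1Norm_le (hident : ∀ n, IdentDistrib (Z n) (Z 0) P P)
    (hZ : momentSum b 2 P (Z 0) ≠ ∞) {η : ℝ≥0} (hη : η ≠ 0) {ε : ℝ≥0∞} (hε : ε ≠ 0) :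
    ∀ᶠ N : ℕ in atTop, P {ω | ∃ n < N, (η * N : ℝ≥0) < l1Norm b (Z n ω)} ≤ ε := by
  have hlim : Tendsto (fun N : ℕ => (momentSum b 2 P (Z 0) ^ 2 / η ^ 2) * (N : ℝ≥0∞)⁻¹) atTop
      (𝓝 0) := by
    simpa using ENNReal.Tendsto.const_mul ENNReal.tendsto_inv_nat_nhds_zero
      (Or.inr (ENNReal.div_ne_top (ENNReal.pow_ne_top hZ) (by simpa using hη)))
  filter_upwards [hlim.eventually_le_const (pos_iff_ne_zero.2 hε), eventually_ne_atTop 0]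
    with N hN hN0
  calc P {ω | ∃ n < N, (η * N : ℝ≥0) < l1Norm b (Z n ω)}
      ≤ P (⋃ n ∈ Finset.range N, {ω | (η * N : ℝ≥0) < l1Norm b (Z n ω)}) :=
        measure_mono fun ω ⟨n, hn, hω⟩ =>
          Set.mem_biUnion (Finset.mem_coe.2 (Finset.mem_range.2 hn)) hω
    _ ≤ ∑ n ∈ Finset.range N, P {ω | (η * N : ℝ≥0) < l1Norm b (Z n ω)} :=
        measure_biUnion_finset_le _ _
    _ ≤ ∑ n ∈ Finset.range N, momentSum b 2 P (Z 0) ^ 2 / (η * N : ℝ≥0) ^ 2 := by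
        gcongr with n
        exact measure_lt_l1Norm_le hident n (mul_ne_zero hη (Nat.cast_ne_zero.2 hN0))
    _ = (momentSum b 2 P (Z 0) ^ 2 / η ^ 2) * (N : ℝ≥0∞)⁻¹ := by
        rw [Finset.sum_const, Finset.card_range, nsmul_eq_mul, ENNReal.coe_mul, mul_pow,
          ENNReal.coe_natCast, div_eq_mul_inv, div_eq_mul_inv,
          ENNReal.mul_inv (.inr (by simp)) (.inl (by simp)), pow_two (N : ℝ≥0∞),
          ENNReal.mul_inv (.inr (by simp)) (.inr (by simpa using hN0))]
        calc _ = (N * (N : ℝ≥0∞)⁻¹) * (momentSum b 2 P (Z 0) ^ 2 * ((η : ℝ≥0∞) ^ 2)⁻¹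
              * (N : ℝ≥0∞)⁻¹) := by ring
          _ = _ := by
            rw [ENNReal.mul_inv_cancel (Nat.cast_ne_zero.2 hN0) (ENNReal.natCast_ne_top N), one_mul]
    _ ≤ ε := hN

end SampleAverage

section Rate

instance holderTriple_four_four_two : ENNReal.HolderTriple 4 4 2 where
  inv_add_inv_eq_inv := by
    rw [← two_mul, show (4 : ℝ≥0∞) = 2 * 2 by norm_num,
      ENNReal.mul_inv (.inl two_ne_zero) (.inl ENNReal.ofNat_ne_top),
      ENNReal.mul_inv_cancel_left two_ne_zero ENNReal.ofNat_ne_top]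

lemma continuous_outer_self {α : Type*} [MeasureSpace α] [SFinite (volume : Measure α)] :
    Continuous fun x : L2 α => outer x x :=
  (outerL (α := α) (β := α)).continuous.clm_apply continuous_id

lemma tendsto_const_mul_inv_sqrt_natCast (R : ℝ≥0) :
    Tendsto (fun N : ℕ => R * (NNReal.sqrt N)⁻¹) atTop (𝓝 0) := by
  have h : Tendsto (fun N : ℕ => (N : ℝ≥0)⁻¹) atTop (𝓝 0) :=
    tendsto_inv_atTop_zero.comp tendsto_natCast_atTop_atTop
  simpa [Function.comp_def, ← NNReal.sqrt_inv] using
    ((NNReal.continuous_sqrt.tendsto _).comp h).const_mul R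

lemma eventually_le_const_mul_natCast {m : ℝ≥0∞} (hm : m ≠ ∞) {η : ℝ≥0} (hη : 0 < η) :
    ∀ᶠ N : ℕ in atTop, m ≤ η * N := by
  lift m to ℝ≥0 using hm
  filter_upwards [(tendsto_natCast_atTop_atTop.const_mul_atTop hη).eventually_ge_atTop m] with N hN
  exact_mod_cast hN

lemma l1Norm_empCov_sub_le_of_le {e : HilbertBasis ℕ ℝ Surface} {c : SurfaceOp} {x : ℕ → Surface}
    {S : Finset ℕ} {r r' : ℝ≥0} (hsecond : l1Norm (outerBasis e e) (secondMoment x S - c) ≤ r)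
    (hmean : l1Norm e (sampleMean x S) ≤ r') (hr' : r' ≤ 1) :
    l1Norm (outerBasis e e) (empCov x S - c) ≤ (r + r' : ℝ≥0) := by
  refine (l1Norm_empCov_sub_le e c x S).trans ?_
  rw [ENNReal.coe_add]
  gcongr
  exact (pow_le_of_le_one zero_le (hmean.trans (by exact_mod_cast hr')) two_ne_zero).trans hmean

variable {Ω : Type*} [MeasurableSpace Ω] {P : Measure Ω} {e : HilbertBasis ℕ ℝ Surface}

lemma momentSum_outerBasis_outer_self_ne_top {Y : Ω → Surface} (hY : AEStronglyMeasurable Y P)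
    (h : momentSum e 4 P Y ≠ ∞) :
    momentSum (outerBasis e e) 2 P (fun ω => outer (Y ω) (Y ω)) ≠ ∞ :=
  ne_top_of_le_ne_top (ENNReal.mul_ne_top h h) (momentSum_outerBasis_outer_le e e hY hY)

lemma covariance_eq_integral_outer_self {Y : Ω → Surface} (hmean : ∫ ω, Y ω ∂P = 0) :
    covariance P Y = ∫ ω, outer (Y ω) (Y ω) ∂P := by
  simp only [covariance, hmean, sub_zero]

lemma l1Norm_covariance_ne_top [IsProbabilityMeasure P] {Y : Ω → Surface}
    (hY : AEStronglyMeasurable Y P) (hmean : ∫ ω, Y ω ∂P = 0) (h : momentSum e 4 P Y ≠ ∞) :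
    l1Norm (outerBasis e e) (covariance P Y) ≠ ∞ := by
  have houter : AEStronglyMeasurable (fun ω => outer (Y ω) (Y ω)) P :=
    continuous_outer_self.comp_aestronglyMeasurable hY
  have h₁ : momentSum (outerBasis e e) 1 P (fun ω => outer (Y ω) (Y ω)) ≠ ∞ :=
    ne_top_of_le_ne_top (momentSum_outerBasis_outer_self_ne_top hY h)
      (momentSum_le_of_exponent_le one_le_two houter)
  rw [covariance_eq_integral_outer_self hmean]
  exact ne_top_of_le_ne_top h₁ (l1Norm_integral_le houter h₁)

variable [MeasurableSpace Surface] [BorelSpace Surface] {X : ℕ → Ω → Surface} {ε : ℝ≥0∞}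

lemma eventually_measure_exists_lt_l1Norm_sq_le (hident : ∀ n, IdentDistrib (X n) (X 0) P P)
    (hX : momentSum e 4 P (X 0) ≠ ∞) {η : ℝ≥0} (hη : η ≠ 0) (hε : ε ≠ 0) :
    ∀ᶠ N : ℕ in atTop, P {ω | ∃ n < N, (η * N : ℝ≥0) < l1Norm e (X n ω) ^ 2} ≤ ε := by
  have := secondCountableTopology_of_hilbertBasis e
  let : MeasurableSpace SurfaceOp := borel _
  have : BorelSpace SurfaceOp := ⟨rfl⟩
  simpa only [l1Norm_outerBasis_outer, ← pow_two] using
    eventually_measure_exists_lt_l1Norm_le (b := outerBasis e e)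
      (Z := fun n ω => outer (X n ω) (X n ω))
      (fun n => (hident n).comp continuous_outer_self.measurable)
      (momentSum_outerBasis_outer_self_ne_top
        (hident 0).aemeasurable_fst.aestronglyMeasurable hX) hη hε

variable [IsProbabilityMeasure P]

lemma exists_measure_lt_l1Norm_sampleMean_le
    (hindep : Pairwise fun i j => IndepFun (X i) (X j) P)
    (hident : ∀ n, IdentDistrib (X n) (X 0) P P) (hmean : ∫ ω, X 0 ω ∂P = 0)
    (hX : momentSum e 4 P (X 0) ≠ ∞) (hε : ε ≠ 0) :
    ∃ R : ℝ≥0, ∀ N : ℕ, N ≠ 0 → P {ω | (R * (NNReal.sqrt N)⁻¹ : ℝ≥0) <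
      l1Norm e (sampleMean (fun n => X n ω) (Finset.range N))} ≤ ε := by
  have := secondCountableTopology_of_hilbertBasis e
  have hX₂ : momentSum e 2 P (X 0) ≠ ∞ := ne_top_of_le_ne_top hX
    (momentSum_le_of_exponent_le (by norm_num) (hident 0).aemeasurable_fst.aestronglyMeasurable)
  simpa only [hmean, sub_zero, sampleMean, Finset.card_range] using
    exists_measure_lt_l1Norm_average_sub_le hindep hident hX₂ hε

lemma exists_measure_lt_l1Norm_secondMoment_sub_le
    (hindep : Pairwise fun i j => IndepFun (X i) (X j) P)
    (hident : ∀ n, IdentDistrib (X n) (X 0) P P) (hmean : ∫ ω, X 0 ω ∂P = 0)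
    (hX : momentSum e 4 P (X 0) ≠ ∞) (hε : ε ≠ 0) :
    ∃ R : ℝ≥0, ∀ N : ℕ, N ≠ 0 → P {ω | (R * (NNReal.sqrt N)⁻¹ : ℝ≥0) < l1Norm (outerBasis e e)
      (secondMoment (fun n => X n ω) (Finset.range N) - covariance P (X 0))} ≤ ε := by
  have := secondCountableTopology_of_hilbertBasis e
  let : MeasurableSpace SurfaceOp := borel _
  have : BorelSpace SurfaceOp := ⟨rfl⟩
  have houter : Measurable fun x : Surface => outer x x := continuous_outer_self.measurable
  simpa only [covariance_eq_integral_outer_self hmean, secondMoment, Finset.card_range] using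
    exists_measure_lt_l1Norm_average_sub_le (Z := fun n ω => outer (X n ω) (X n ω))
      (fun m n hmn => (hindep hmn).comp houter houter) (fun n => (hident n).comp houter)
      (momentSum_outerBasis_outer_self_ne_top
        (hident 0).aemeasurable_fst.aestronglyMeasurable hX) hε

lemma exists_eventually_measure_not_isTypicalSample_le
    (hindep : Pairwise fun i j => IndepFun (X i) (X j) P)
    (hident : ∀ n, IdentDistrib (X n) (X 0) P P) (hmean : ∫ ω, X 0 ω ∂P = 0)
    (hX : momentSum e 4 P (X 0) ≠ ∞) {η : ℝ≥0} (hη : η ∈ Set.Ioc 0 1) (hε : ε ≠ 0) :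
    ∃ R : ℝ≥0, ∀ᶠ N : ℕ in atTop, P {ω | ¬ (
      IsTypicalSample e (covariance P (X 0)) (fun n => X n ω) N η ∧
      l1Norm (outerBasis e e) (empCov (fun n => X n ω) (Finset.range N) - covariance P (X 0)) ≤
        (R * (NNReal.sqrt N)⁻¹ : ℝ≥0))} ≤ ε := by
  have := secondCountableTopology_of_hilbertBasis e
  have hc := l1Norm_covariance_ne_top (hident 0).aemeasurable_fst.aestronglyMeasurable hmean hX
  have hε₃ : ε / 3 ≠ 0 := by simpa using hε
  obtain ⟨R₁, hR₁⟩ := exists_measure_lt_l1Norm_secondMoment_sub_le hindep hident hmean hX hε₃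
  obtain ⟨R₂, hR₂⟩ := exists_measure_lt_l1Norm_sampleMean_le hindep hident hmean hX hε₃
  refine ⟨R₁ + R₂, ?_⟩
  filter_upwards [eventually_ge_atTop 2, eventually_le_const_mul_natCast hc hη.1,
    (tendsto_const_mul_inv_sqrt_natCast R₁).eventually_le_const hη.1,
    (tendsto_const_mul_inv_sqrt_natCast R₂).eventually_le_const hη.1,
    eventually_measure_exists_lt_l1Norm_sq_le hident hX (pow_pos hη.1 2).ne' hε₃]
    with N hN hcovN hη₁ hη₂ hsq
  have hN0 : N ≠ 0 := by lia
  rw [← ENNReal.add_thirds ε]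
  refine (measure_mono ?_).trans ((measure_union_le _ _).trans
    (add_le_add ((measure_union_le _ _).trans (add_le_add (hR₁ N hN0) (hR₂ N hN0))) hsq))
  intro ω hω
  by_contra hgood
  simp only [Set.mem_union, Set.mem_ofPred_eq, not_or, not_lt, not_exists, not_and] at hgood
  obtain ⟨⟨hsecond, hmeanN⟩, hsqN⟩ := hgood
  refine hω ⟨⟨hN, hη.2, hcovN, hsecond.trans (by exact_mod_cast hη₁),
    hmeanN.trans (by exact_mod_cast hη₂), fun n hn => (hsqN n hn).trans_eq (by simp)⟩, ?_⟩
  rw [add_mul]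
  exact l1Norm_empCov_sub_le_of_le hsecond hmeanN (hη₂.trans hη.2)

lemma isBigOInProbability_norm_sq_of_isTypicalSample {E : Type*} [SeminormedAddCommGroup E]
    (hindep : Pairwise fun i j => IndepFun (X i) (X j) P)
    (hident : ∀ n, IdentDistrib (X n) (X 0) P P) (hmean : ∫ ω, X 0 ω ∂P = 0)
    (hX : momentSum e 4 P (X 0) ≠ ∞) {η L : ℝ≥0} (hη : η ∈ Set.Ioc 0 1) {D : ℕ → Ω → E}
    (hD : ∀ᶠ r : ℝ≥0 in 𝓝 0, ∀ N, 2 ≤ N → ∀ᵐ ω ∂P,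
      IsTypicalSample e (covariance P (X 0)) (fun n => X n ω) N η →
      l1Norm (outerBasis e e) (empCov (fun n => X n ω) (Finset.range N) - covariance P (X 0)) ≤ r →
      ‖D N ω‖ ≤ L * r) :
    IsBigOInProbability P (fun N ω => ‖D N ω‖ ^ 2) (fun N => (N : ℝ)⁻¹) := by
  intro ε hε
  obtain ⟨R, hR⟩ := exists_eventually_measure_not_isTypicalSample_le hindep hident hmean hX hη
    (ENNReal.ofReal_pos.2 hε).ne'
  refine ⟨(L * R) ^ 2 + 1, by positivity, ?_⟩
  filter_upwards [hR, (tendsto_const_mul_inv_sqrt_natCast R).eventually hD, eventually_ge_atTop 2]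
    with N hprob hDN hN
  refine (measure_mono_ae ?_).trans hprob
  filter_upwards [hDN N hN] with ω hω hlarge ⟨htyp, hclose⟩
  have hsmall : ‖D N ω‖ ^ 2 ≤ (L * R) ^ 2 * (N : ℝ)⁻¹ := by
    calc ‖D N ω‖ ^ 2 ≤ (L * (R * (NNReal.sqrt N)⁻¹ : ℝ≥0)) ^ 2 := by gcongr; exact hω htyp hclose
      _ = (L * R) ^ 2 * (N : ℝ)⁻¹ := by
        push_cast
        rw [← mul_assoc, mul_pow, inv_pow, Real.sq_sqrt (Nat.cast_nonneg N)]
  replace hlarge : ((L * R) ^ 2 + 1) * (N : ℝ)⁻¹ < |‖D N ω‖ ^ 2| := hlarge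
  rw [abs_of_nonneg (by positivity)] at hlarge
  have : 0 ≤ (N : ℝ)⁻¹ := by positivity
  linarith

end Rate

end SepBand

end

theorem theorem2_general
    {Ω : Type*} [MeasurableSpace Ω] (P : Measure Ω) [IsProbabilityMeasure P]
    [MeasurableSpace SepBand.Surface] [BorelSpace SepBand.Surface]
    (X : ℕ → Ω → SepBand.Surface)
    (hindep : Pairwise fun i j => IndepFun (X i) (X j) P)
    (hident : ∀ n, IdentDistrib (X n) (X 0) P P)
    (hcentred : ∫ ω, X 0 ω ∂P = 0)
    (hA1 : SepBand.MomentCondition P (X 0))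
    (A₁ A₂ : SepBand.CurveOp) (B : SepBand.SurfaceOp)
    (hA₁ : SepBand.IsTraceClass A₁) (hA₂ : SepBand.IsTraceClass A₂) (hB : SepBand.IsTraceClass B)
    (hmodel : SepBand.covariance P (X 0) = SepBand.opTensor A₁ A₂ + B)
    (hstat : B ∈ SepBand.stationary) (δstar : ℝ) (hband : SepBand.IsBanded δstar B)
    (Δ : Finset ℝ) (htrace : ∀ δ ∈ Δ, SepBand.shiftedTrace δ (SepBand.covariance P (X 0)) ≠ 0)
    (hgrid : ∃ δ ∈ Δ, δstar ≤ δ)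
    (hmin : δstar ∈ lowerBounds
      (SepBand.argminOn Δ (SepBand.theoreticalCriterion (SepBand.covariance P (X 0)))))
    (δhat : ℕ → Ω → ℝ)
    (hδhat : ∀ N, 2 ≤ N → ∀ᵐ ω ∂P,
      δhat N ω ∈ SepBand.argminOn Δ (SepBand.cvCriterion (fun n => X n ω) N)) :
    SepBand.IsBigOInProbability P
      (fun N ω => ‖SepBand.separablePart (δhat N ω)
          (SepBand.empCov (fun n => X n ω) (Finset.range N)) - SepBand.opTensor A₁ A₂‖ ^ 2)
      (fun N => (N : ℝ)⁻¹) ∧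
    SepBand.IsBigOInProbability P
      (fun N ω => ‖SepBand.bandedPart (δhat N ω)
          (SepBand.empCov (fun n => X n ω) (Finset.range N)) - B‖ ^ 2)
      (fun N => (N : ℝ)⁻¹) := by
  obtain ⟨e, he⟩ := hA1
  have hmoment : SepBand.momentSum e 4 P (X 0) ≠ ∞ := he.ne
  have := SepBand.secondCountableTopology_of_hilbertBasis e
  have hc := SepBand.l1Norm_covariance_ne_top
    (hident 0).aemeasurable_fst.aestronglyMeasurable hcentred hmoment
  rw [hmodel] at hc htrace hmin
  obtain ⟨η, hη, L, hL⟩ := SepBand.exists_norm_estimators_sub_le hA₁ hA₂ hB hstat hband hc htrace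
    hgrid hmin
  constructor <;>
    refine SepBand.isBigOInProbability_norm_sq_of_isTypicalSample (L := L) hindep hident hcentred
      hmoment hη (hL.mono fun r hr N hN => (hδhat N hN).mono fun ω hω htyp hclose => ?_) <;>
    rw [hmodel] at htyp hclose
  · exact (hr _ N htyp hclose _ hω).1
  · exact (hr _ N htyp hclose _ hω).2

theorem theorem2
    {Ω : Type*} [MeasurableSpace Ω] (P : Measure Ω) [IsProbabilityMeasure P]
    [MeasurableSpace SepBand.Surface] [BorelSpace SepBand.Surface]
    -- the random sample
    (X : ℕ → Ω → SepBand.Surface)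
    (hindep : iIndepFun X P) (hident : ∀ n, IdentDistrib (X n) (X 0) P P)
    (hcentred : ∫ ω, X 0 ω ∂P = 0)
    (hA1 : SepBand.MomentCondition P (X 0))
    -- the separable-plus-banded model for the covariance
    (A₁ A₂ : SepBand.CurveOp) (B : SepBand.SurfaceOp)
    (hA₁ : SepBand.IsTraceClass A₁ ∧ SepBand.IsPSD A₁)
    (hA₂ : SepBand.IsTraceClass A₂ ∧ SepBand.IsPSD A₂)
    (hB : SepBand.IsTraceClass B ∧ SepBand.IsPSD B)
    (hmodel : SepBand.covariance P (X 0) = SepBand.opTensor A₁ A₂ + B)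
    (hstat : B ∈ SepBand.stationary)
    (δstar : ℝ) (hδstar : δstar ∈ Set.Ico (0 : ℝ) 1) (hband : SepBand.IsBanded δstar B)
    -- the grid of candidate bandwidths
    (Δ : Finset ℝ) (hΔ : ∀ δ ∈ Δ, δ ∈ Set.Ico (0 : ℝ) 1)
    (htrace : ∀ δ ∈ Δ, SepBand.shiftedTrace δ (SepBand.covariance P (X 0)) ≠ 0)
    (hgrid : ∃ δ ∈ Δ, δstar ≤ δ)
    (hmin : δstar ∈ lowerBounds
      (SepBand.argminOn Δ (SepBand.theoreticalCriterion (SepBand.covariance P (X 0)))))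
    -- the data-driven bandwidth
    (δhat : ℕ → Ω → ℝ)
    (hδhat : ∀ N, 2 ≤ N → ∀ᵐ ω ∂P,
      δhat N ω ∈ SepBand.argminOn Δ (SepBand.cvCriterion (fun n => X n ω) N)) :
    SepBand.IsBigOInProbability P
      (fun N ω => ‖SepBand.separablePart (δhat N ω)
          (SepBand.empCov (fun n => X n ω) (Finset.range N)) - SepBand.opTensor A₁ A₂‖ ^ 2)
      (fun N => (N : ℝ)⁻¹) ∧
    SepBand.IsBigOInProbability P
      (fun N ω => ‖SepBand.bandedPart (δhat N ω)
          (SepBand.empCov (fun n => X n ω) (Finset.range N)) - B‖ ^ 2)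
      (fun N => (N : ℝ)⁻¹) :=
  theorem2_general P X (fun _ _ h => hindep.indepFun h) hident hcentred hA1 A₁ A₂ B hA₁.1 hA₂.1
    hB.1 hmodel hstat δstar hband Δ htrace hgrid hmin δhat hδhat
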